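/- Conventions. $\mathbb N=\{1,2,\dots\}$, $\mathbb N_0=\mathbb N\cup\{0\}$, $\inf\emptyset=\infty$. For $N\in\mathbb N$ let $\mathcal C_N$ be the set of sequences $x\colon\mathbb N_0\to\{0,\dots,N\}$ such that $x(i)=0$ implies $x(j)=0$ for all $j\ge i$. For a sequence $x\colon\mathbb N_0\to\mathbb N_0$ put $I_{x,N}(0)=\inf\{i: x(i)\le N\}$, $I_{x,N}(j+1)=\inf\{i>I_{x,N}(j): x(i)\le N\}$, and let $P_N(x)(j)=x(I_{x,N}(j))$ if $I_{x,N}(j)<\infty$ and $P_N(x)(j)=0$ otherwise. The space of virtual paths is $\boldsymbol{\mathcal C}=\{(x_N)_{N\in\mathbb N}\in\prod_N\mathcal C_N : P_N(x_{N+1})=x_N\text{ for all }N\}$ with its Borel $\sigma$-algebra. A virtual Markov chain (VMC) on a probability space is a $\boldsymbol{\mathcal C}$-valued random variable $(X_N)_{N\in\mathbb N}$ such that each $X_N$ is a time-homogeneous Markov chain in $\{0,\dots,N\}$ for which $0$ is absorbing. A Radon space is a topological space homeomorphic to a universally measurable subset of a compact metric space. A right process $(\Omega,\mathcal F,(\mathcal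 F_t)_{t\ge0},(Y_t)_{t\ge0},(\theta_t)_{t\ge0},(\mathbb P_x)_{x\in S})$ in a Radon space $S$ (with its Borel $\sigma$-algebra) consists of a measurable space $(\Omega,\mathcal F)$ with a filtration $(\mathcal F_t)$, adapted $S$-valued random variables $Y_t$, measurable maps $\theta_t\colon\Omega\to\Omega$ with $\theta_{s+t}=\theta_s\circ\theta_t$ and $Y_s\circ\theta_t=Y_{t+s}$, and probability measures $\mathbb P_x$ on $(\Omega,\mathcal F)$, such that: (1) $P(t,x,\Gamma)=\mathbb P_x(Y_t\in\Gamma)$ is universally measurable in $x$, and $\mathbb P_x(Y_{t+s}\in\Gamma\mid\mathcal F_t)=P(s,Y_t,\Gamma)$ $\mathbb P_x$-a.s., for all $s,t\ge0$, $x\in S$ and Borel $\Gamma$; (2) $\mathcal F_t=\bigcap_{u>t}\mathcal F_u=\bigcap_\mu(\mathcal F_t\vee\mathcal N^\mu)$, where $\mu$ runs over the Borel probability measures on $S$ and $\mathcal N^\mu$ is the collection of all subsets of sets $A\in\mathcal F$ with $\mathbb P_x(A)=0$ for $\mu$-almost every $x$; (3) the event that $t\mapsto Y_t$ is right-continuous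 belongs to $\mathcal F$ and has $\mathbb P_x$-probability one for every $x$, and $P(0,x,\{x\})=1$ for every $x$; (4) (HD1) for every Borel probability measure $\mu$ on $S$ there is a probability measure on the space of right-continuous paths in $S$ under which the coordinate process has initial law $\mu$ and is Markov in its own filtration with transition function $P$; (5) (HD2) if $\alpha>0$ and $f\colon S\to[0,\infty]$ is $\alpha$-excessive (that is, $f$ is universally measurable, $e^{-\alpha t}\mathbb E_x[f(Y_t)]\le f(x)$ for all $t,x$, and $e^{-\alpha t}\mathbb E_x[f(Y_t)]\to f(x)$ as $t\downarrow0$ for all $x$), then $t\mapsto f(Y_t)$ is right-continuous $\mathbb P_x$-a.s. for every $x$. Lemma. Let $Y$ be a right process in a Radon space $S$ as above, and let $(L_N)_{N\in\mathbb N}$ be distinct points of $S$, each irregular for itself: $\mathbb P_{L_N}(\inf\{t>0:Y_t=L_N\}>0)=1$. For $N\in\mathbb N$ put $\tau^N_0=\inf\{t\ge0:Y_t\in\{L_1,\dots,L_N\}\}$ and $\tau^N_{j+1}=\inf\{t>\tau^N_j:Y_t\in\{L_1,\dots,L_N\}\}$ for $j\in\mathbb N_0$. Then: (a) every $\tau^N_j$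 is an $(\mathcal F_t)$-stopping time; (b) for every $x\in S$, $\mathbb P_x$-almost surely, for all $N$ and $j$ we have $\tau^N_j\le\tau^N_{j+1}$, and $\tau^N_j<\tau^N_{j+1}$ if $\tau^N_j<\infty$; (c) for every $x\in S$, $\mathbb P_x$-almost surely, for all $N$ and $j$ with $\tau^N_j<\infty$ there is exactly one $a\in\{1,\dots,N\}$ with $Y_{\tau^N_j}=L_a$; (d) there is a map $\mathbf X=(X_N)_{N\in\mathbb N}\colon\Omega\to\boldsymbol{\mathcal C}$ which is a VMC on $(\Omega,\mathcal F,\mathbb P_x)$ for every $x\in S$ and which satisfies, $\mathbb P_x$-almost surely for every $x\in S$, for all $N$ and $j$: $X_N(j)=a$ if $\tau^N_j<\infty$ and $Y_{\tau^N_j}=L_a$ with $a\in\{1,\dots,N\}$, and $X_N(j)=0$ if $\tau^N_j=\infty$. -/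

import Mathlib

open MeasureTheory Filter Topology Set
open scoped NNReal ENNReal

namespace VMC

noncomputable section

/-! ### Paths and virtual paths -/

/-- The space `C_N` of paths in `{0, ..., N}` which stay at the cemetery `0` once they visit it. -/
def paths (N : ℕ) : Set (ℕ → ℕ) :=
  {x | (∀ i, x i ≤ N) ∧ ∀ i, x i = 0 → ∀ j, i ≤ j → x j = 0}

/-- The index (possibly infinite) of the `j`-th visit of `x` to `{0, ..., N}`. -/
def visitIndex (N : ℕ) (x : ℕ → ℕ) : ℕ → ℕ∞
  | 0 => sInf ((fun i : ℕ => (i : ℕ∞)) '' {i | x i ≤ N})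
  | j + 1 => sInf ((fun i : ℕ => (i : ℕ∞)) '' {i | visitIndex N x j < (i : ℕ∞) ∧ x i ≤ N})

/-- The projection `P_N`: delete from `x` all states larger than `N`, padding with `0`
if only finitely many indices remain. -/
def proj (N : ℕ) (x : ℕ → ℕ) (j : ℕ) : ℕ :=
  if visitIndex N x j = ⊤ then 0 else x (visitIndex N x j).toNat

/-- The space of virtual paths. As a subtype of a countable product of countable discrete spaces
it carries the product sigma-algebra, which is its Borel sigma-algebra. -/
def VirtualPath : Type :=
  {x : ℕ+ → ℕ → ℕ // (∀ N : ℕ+, x N ∈ paths N) ∧ ∀ N : ℕ+, proj N (x (N + 1)) = x N}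

instance : MeasurableSpace VirtualPath :=
  inferInstanceAs (MeasurableSpace {x : ℕ+ → ℕ → ℕ //
    (∀ N : ℕ+, x N ∈ paths N) ∧ ∀ N : ℕ+, proj N (x (N + 1)) = x N})

/-! ### Virtual Markov chains -/

/-- `X` is a (time-homogeneous) Markov chain in `{1, ..., N}` with cemetery `0`: it is a random
sequence in `{0, ..., N}` with a transition matrix `K` for which `0` is absorbing. -/
structure IsMarkovChainWithCemetery {Ω : Type*} [MeasurableSpace Ω] (μ : Measure Ω) (N : ℕ)
    (X : ℕ → Ω → ℕ) : Prop where
  measurable : ∀ i, Measurable (X i)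
  le : ∀ i ω, X i ω ≤ N
  exists_transition : ∃ K : Fin (N + 1) → Fin (N + 1) → ℝ,
    (∀ a b, 0 ≤ K a b) ∧ (∀ a, ∑ b, K a b = 1) ∧ K 0 0 = 1 ∧
    ∀ (l : ℕ) (a : ℕ → Fin (N + 1)),
      μ.real {ω | ∀ i, i ≤ l + 1 → X i ω = (a i : ℕ)} =
        μ.real {ω | ∀ i, i ≤ l → X i ω = (a i : ℕ)} * K (a l) (a (l + 1))

/-- `X` is a virtual Markov chain on the probability space `(Ω, μ)`. -/
structure IsVMC {Ω : Type*} [MeasurableSpace Ω] (μ : Measure Ω) (X : Ω → VirtualPath) : Prop where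
  measurable : Measurable X
  markov : ∀ N : ℕ+, IsMarkovChainWithCemetery μ N (fun i ω => (X ω).1 N i)

/-! ### Radon spaces and right processes -/

/-- A Radon space: a space homeomorphic to a universally measurable subset of a compact metric
space. -/
def IsRadonSpace.{u} (S : Type u) [TopologicalSpace S] : Prop :=
  ∃ (K : Type u) (_ : TopologicalSpace K) (_ : MeasurableSpace K) (_ : BorelSpace K)
    (_ : CompactSpace K) (_ : TopologicalSpace.MetrizableSpace K) (f : S → K),
    IsEmbedding f ∧ ∀ μ : ProbabilityMeasure K, NullMeasurableSet (range f) (μ : Measure K)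

/-- Universal measurability of a function with values in `[0, ∞]`. -/
def UniversallyMeasurable {S : Type*} [MeasurableSpace S] (f : S → ℝ≥0∞) : Prop :=
  ∀ μ : ProbabilityMeasure S, AEMeasurable f (μ : Measure S)

/-- Right-continuity of a function on `[0, ∞)`. -/
def IsRightCont {E : Type*} [TopologicalSpace E] (w : ℝ≥0 → E) : Prop :=
  ∀ t, ContinuousWithinAt w (Ici t) t

/-- The Markov property of the process `Z` under `μ`, with respect to the sigma-algebras `𝒢 t`
and the transition function `p`:
`μ(Z (t + s) ∈ Γ | 𝒢 t) = p s (Z t) Γ` almost surely. -/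
def MarkovProperty {S Ω : Type*} [MeasurableSpace S] [MeasurableSpace Ω] (μ : Measure Ω)
    (𝒢 : ℝ≥0 → MeasurableSpace Ω) (Z : ℝ≥0 → Ω → S) (p : ℝ≥0 → S → Set S → ℝ≥0∞) : Prop :=
  ∀ (t s : ℝ≥0) (Γ : Set S), MeasurableSet Γ →
    μ[(Z (t + s) ⁻¹' Γ).indicator (fun _ => (1 : ℝ)) | 𝒢 t] =ᵐ[μ]
      fun ω => (p s (Z t ω) Γ).toReal

section RightProc

variable {S Ω : Type*} [TopologicalSpace S] [MeasurableSpace S] {mΩ : MeasurableSpace Ω}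

/-- The transition function `P(t, x, Γ) = P_x(Y_t ∈ Γ)`. -/
def transition (Y : ℝ≥0 → Ω → S) (P : S → Measure Ω) (t : ℝ≥0) (x : S) (Γ : Set S) : ℝ≥0∞ :=
  P x (Y t ⁻¹' Γ)

/-- `(Ω, ℱ, (ℱ_t), (Y_t), (θ_t), (P_x))` is a Markov process in `S`. -/
structure IsMarkovProcess (F : Filtration ℝ≥0 mΩ) (Y : ℝ≥0 → Ω → S) (θ : ℝ≥0 → Ω → Ω)
    (P : S → Measure Ω) : Prop where
  adapted : ∀ t, Measurable[F t] (Y t)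
  measurable_shift : ∀ t, Measurable (θ t)
  shift_add : ∀ s t, θ (s + t) = θ s ∘ θ t
  shift : ∀ s t, Y s ∘ θ t = Y (t + s)
  isProbabilityMeasure : ∀ x, IsProbabilityMeasure (P x)
  measurable_transition : ∀ (t : ℝ≥0) (Γ : Set S), MeasurableSet Γ →
    UniversallyMeasurable fun x => transition Y P t x Γ
  markov : ∀ x, MarkovProperty (P x) F Y (transition Y P)

/-- The collection of all subsets of `P_μ`-null measurable sets, where
`P_μ(A) = ∫ P_x(A) dμ(x)`; thus `P_μ(A) = 0` means that `P_x(A) = 0` for `μ`-almost every `x`. -/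
def nullSets (P : S → Measure Ω) (μ : Measure S) : Set (Set Ω) :=
  {B | ∃ A, MeasurableSet A ∧ B ⊆ A ∧ ∀ᵐ x ∂μ, P x A = 0}

/-- `f` is `α`-excessive for the semigroup `P_t f (x) = E_x[f(Y_t)]`: it is universally
measurable, `e^{-αt} P_t f ≤ f` for all `t`, and `e^{-αt} P_t f → f` pointwise as `t ↓ 0`. -/
structure IsExcessive (Y : ℝ≥0 → Ω → S) (P : S → Measure Ω) (α : ℝ) (f : S → ℝ≥0∞) : Prop where
  measurable : UniversallyMeasurable f
  le : ∀ (t : ℝ≥0) (x : S), ENNReal.ofReal (Real.exp (-(α * t))) * ∫⁻ ω, f (Y t ω) ∂(P x) ≤ f x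
  tendsto : ∀ x : S,
    Tendsto (fun t : ℝ≥0 => ENNReal.ofReal (Real.exp (-(α * t))) * ∫⁻ ω, f (Y t ω) ∂(P x))
      (𝓝[>] 0) (𝓝 (f x))

/-- (HD1): for every initial law `μ` there is a probability measure on the space of right-continuous
paths in `S`, with the sigma-algebra generated by the coordinates, under which the coordinate
process has initial law `μ` and is Markov (in its own filtration) with the given transition
function. -/
def HD1 (p : ℝ≥0 → S → Set S → ℝ≥0∞) : Prop :=
  ∀ μ : ProbabilityMeasure S, ∃ Q : Measure {w : ℝ≥0 → S // IsRightCont w},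
    IsProbabilityMeasure Q ∧ Q.map (fun w => w.1 0) = μ ∧
    MarkovProperty Q (fun t => ⨆ r : Iic t, MeasurableSpace.comap (fun w => w.1 r) inferInstance)
      (fun t w => w.1 t) p

/-- (HD2): along almost every sample path, every `α`-excessive function (`α > 0`) is
right-continuous. -/
def HD2 (Y : ℝ≥0 → Ω → S) (P : S → Measure Ω) : Prop :=
  ∀ (α : ℝ) (f : S → ℝ≥0∞), 0 < α → IsExcessive Y P α f →
    ∀ x, ∀ᵐ ω ∂(P x), IsRightCont fun t => f (Y t ω)

/-- `(Ω, ℱ, (ℱ_t), (Y_t), (θ_t), (P_x))` is a right process in the Radon space `S`. The event that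
the sample path is right-continuous belongs to `ℱ` and has probability one under every `P_x`. -/
structure IsRightProcess (F : Filtration ℝ≥0 mΩ) (Y : ℝ≥0 → Ω → S) (θ : ℝ≥0 → Ω → Ω)
    (P : S → Measure Ω) : Prop extends IsMarkovProcess F Y θ P where
  radon : IsRadonSpace S
  filtration_rightCont : ∀ t, F t = ⨅ u : Ioi t, F u
  filtration_augmented : ∀ t, F t =
    ⨅ μ : ProbabilityMeasure S, F t ⊔ MeasurableSpace.generateFrom (nullSets P (μ : Measure S))
  measurableSet_rightCont : MeasurableSet {ω | IsRightCont fun t => Y t ω}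
  rightCont : ∀ x, ∀ᵐ ω ∂(P x), IsRightCont fun t => Y t ω
  normal : ∀ x, transition Y P 0 x {x} = 1
  hd1 : HD1 (transition Y P)
  hd2 : HD2 Y P

/-! ### Hitting times -/

/-- `inf {t ≥ 0 : Y_t ∈ A}`, equal to `∞` if there is no such `t`. -/
def entryTime (Y : ℝ≥0 → Ω → S) (A : Set S) (ω : Ω) : WithTop ℝ≥0 :=
  sInf ((fun t : ℝ≥0 => (t : WithTop ℝ≥0)) '' {t | Y t ω ∈ A})

/-- `inf {t > r : Y_t ∈ A}`, equal to `∞` if there is no such `t`. -/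
def hitAfter (Y : ℝ≥0 → Ω → S) (A : Set S) (r : WithTop ℝ≥0) (ω : Ω) : WithTop ℝ≥0 :=
  sInf ((fun t : ℝ≥0 => (t : WithTop ℝ≥0)) '' {t | r < (t : WithTop ℝ≥0) ∧ Y t ω ∈ A})

/-- The point `x` is irregular for itself: `P_x(inf {t > 0 : Y_t = x} > 0) = 1`. -/
def IsIrregularForItself (Y : ℝ≥0 → Ω → S) (P : S → Measure Ω) (x : S) : Prop :=
  ∀ᵐ ω ∂(P x), 0 < hitAfter Y {x} 0 ω

/-- The successive hitting times `τ^N_j` of the set `{L_1, ..., L_N}`. -/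
def hitTime (Y : ℝ≥0 → Ω → S) (L : ℕ+ → S) (N : ℕ+) : ℕ → Ω → WithTop ℝ≥0
  | 0 => entryTime Y (L '' Iic N)
  | j + 1 => fun ω => hitAfter Y (L '' Iic N) (hitTime Y L N j ω) ω

end RightProc

end

end VMC

/-! The assertion rests on measurability of hitting events, a strong Markov property at the hitting
times, and the fact that these times do not accumulate.

Measurability: whether a right-continuous path visits a closed set during `[q, t)` is decided by its
values on a countable grid, through the projection of a Borel set. Projections are analytic, hence
universally measurable (`nullMeasurableSet_of_analyticSet`), and the augmentation of the filtration
puts the event in `F t` (`measurableSet_exists_mem_Ico`). Right-continuity of the filtration then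
yields stopping times.

Strong Markov property: averaging a path functional over an exponential time of rate `α` and taking
the expectation under `P y` gives an `α`-excessive function of `y`
(`isExcessive_lintegral_expAverage`). By (HD2) it is right-continuous along paths, so approximating
a stopping time from the right by discrete times gives a resolvent form of the strong Markov
property (`setLIntegral_expAverage_of_eq`). Letting `α → ∞` recovers functionals that are
right-continuous at that time (`setLIntegral_pathFunctional`). It suffices to treat times at which
the process sits at one fixed point, since the sets to be hit are finite.

No accumulation: from a point of `K = {L 1, ..., L N}` the process does not return to `K` at once,
because irregularity excludes that point and right-continuity excludes the others
(`ae_nextHit_pos`). The strong Markov property carries this to every hitting time (`ae_lt_nextHit`).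
Also, for some `c > 0` a return within `c` has probability at most `1/2` from each point of `K`, so
runs of short gaps die out geometrically and the hitting times are unbounded
(`ae_exists_le_of_succ_eq_hitAfter`).

So almost surely every visit is one of the hitting times, and deleting labels above `N` from the
label sequence for `M ≥ N` leaves the one for `N` (`proj_labelAt`). The Markov property of each
sequence is the strong Markov property applied to the event that a given label comes next
(`measure_virtualPath_succ`). -/

namespace VMC

/-! ### Analytic sets are universally measurable -/

/-- A set of sequences containing the compact box `∏ [0, n i]` in its interior contains a cylinder
set over a finite-dimensional box. -/
lemma exists_cylinder_subset_of_box_subset {V : Set (ℕ → ℕ)} (hV : IsOpen V) (n : ℕ → ℕ)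
    (h : {x : ℕ → ℕ | ∀ i, x i ≤ n i} ⊆ V) : ∃ k, {x : ℕ → ℕ | ∀ i < k, x i ≤ n i} ⊆ V := by
  by_contra! hcon
  simp only [Set.not_subset] at hcon
  choose x hx hxV using hcon
  have hK : IsCompact {x : ℕ → ℕ | ∀ i, x i ≤ n i} := by
    have := isCompact_univ_pi (s := fun i : ℕ => Iic (n i)) (fun i => (finite_Iic _).isCompact)
    convert this using 1
    ext y
    simp [Pi.le_def]
  -- Truncation moves the bad sequences into the compact box. Coordinate `i` is altered only for `k
  -- ≤ i`, so the untruncated subsequence has the same limit.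
  obtain ⟨y, hy, φ, hφ, hlim⟩ := hK.tendsto_subseq (x := fun k i => min (x k i) (n i))
    (fun k i => min_le_right _ _)
  have hlim' : Tendsto (fun k => x (φ k)) atTop (𝓝 y) := by
    rw [tendsto_pi_nhds] at hlim ⊢
    intro i
    refine (hlim i).congr' ?_
    filter_upwards [eventually_gt_atTop i] with k hk
    exact min_eq_left (hx (φ k) i (hk.trans_le hφ.le_apply))
  obtain ⟨k, hk⟩ := (hlim'.eventually (hV.mem_nhds (h hy))).exists
  exact hxV _ hk

/-- Inner approximation of continuous images of Baire space by compact sets. -/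
lemma exists_isCompact_subset_range_lt_measure {X : Type*} [TopologicalSpace X] [MeasurableSpace X]
    {μ : Measure X} [μ.OuterRegular] {f : (ℕ → ℕ) → X} (hf : Continuous f) {c : ℝ≥0∞}
    (hc : c < μ (range f)) : ∃ K ⊆ range f, IsCompact K ∧ c ≤ μ K := by
  have step : ∀ (C : Set (ℕ → ℕ)) (k : ℕ), c < μ (f '' C) →
      ∃ m, c < μ (f '' (C ∩ {x | x k ≤ m})) := by
    intro C k hC
    have hU : f '' C = ⋃ m, f '' (C ∩ {x | x k ≤ m}) := by
      rw [← image_iUnion, ← inter_iUnion]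
      congr 1
      rw [eq_comm, inter_eq_left]
      exact fun x _ => mem_iUnion.2 ⟨x k, le_refl (x k)⟩
    have hmono : Monotone fun m => f '' (C ∩ {x | x k ≤ m}) := fun m m' hm =>
      image_mono (inter_subset_inter_right _ fun x (hx : x k ≤ m) => hx.trans hm)
    -- Continuity from below along increasing unions holds for arbitrary sets, so the images need
    -- not be known to be measurable.
    rw [hU, hmono.measure_iUnion] at hC
    exact lt_iSup_iff.1 hC
  choose! m hm using step
  let C : ℕ → Set (ℕ → ℕ) := fun k => Nat.rec univ (fun k D => D ∩ {x | x k ≤ m D k}) k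
  have hC : ∀ k, c < μ (f '' C k) := by
    intro k
    induction k with
    | zero => simpa [C] using hc
    | succ k ih => exact hm _ _ ih
  have hCeq : ∀ k, C k = {x | ∀ i < k, x i ≤ m (C i) i} := by
    intro k
    induction k with
    | zero => simp [C]
    | succ k ih =>
      change C k ∩ {x | x k ≤ m (C k) k} = _
      ext x
      have hx : x ∈ C k ↔ ∀ i < k, x i ≤ m (C i) i := Set.ext_iff.1 ih x
      rw [mem_inter_iff, hx]
      simp only [mem_ofPred_eq, Nat.lt_succ_iff_lt_or_eq, or_imp, forall_and, forall_eq]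
  have hK : IsCompact {x : ℕ → ℕ | ∀ i, x i ≤ m (C i) i} := by
    have := isCompact_univ_pi (s := fun i : ℕ => Iic (m (C i) i))
      (fun i => (finite_Iic _).isCompact)
    convert this using 1
    ext y
    simp [Pi.le_def]
  refine ⟨_, image_subset_range f _, hK.image hf, ?_⟩
  -- The sets `C k` decrease to the box, but their images have no continuity from above. Outer
  -- regularity replaces it: an open set around the compact image already contains the image of some
  -- `C k`.
  refine le_of_forall_gt fun r hr => ?_
  obtain ⟨U, hKU, hU, hUr⟩ := Set.exists_isOpen_lt_of_lt _ _ hr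
  obtain ⟨k, hk⟩ := exists_cylinder_subset_of_box_subset (hU.preimage hf) _
    (image_subset_iff.1 hKU)
  rw [← hCeq] at hk
  exact ((hC k).trans_le (measure_mono (image_subset_iff.2 hk))).trans hUr

/-- Analytic sets are universally measurable. -/
theorem nullMeasurableSet_of_analyticSet {X : Type*} [TopologicalSpace X] [T2Space X]
    [MeasurableSpace X] [OpensMeasurableSpace X] {μ : Measure X} [IsFiniteMeasure μ]
    [μ.OuterRegular] {s : Set X} (hs : AnalyticSet s) : NullMeasurableSet s μ := by
  rw [AnalyticSet] at hs
  rcases hs with rfl | ⟨f, hf, rfl⟩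
  · exact MeasurableSet.empty.nullMeasurableSet
  rcases eq_or_ne (μ (range f)) 0 with h0 | h0
  · exact NullMeasurableSet.of_null h0
  obtain ⟨u, -, hu, hlim⟩ := exists_seq_strictMono_tendsto' (pos_iff_ne_zero.2 h0)
  choose K hKs hK hcK using fun n => exists_isCompact_subset_range_lt_measure (μ := μ) hf (hu n).2
  have hB : MeasurableSet (⋃ n, K n) := MeasurableSet.iUnion fun n => (hK n).measurableSet
  have hle : μ (range f) ≤ μ (⋃ n, K n) :=
    le_of_tendsto' hlim fun n => (hcK n).trans (measure_mono (subset_iUnion K n))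
  have hsub : (⋃ n, K n) ⊆ range f := iUnion_subset hKs
  have h1 : (⋃ n, K n) =ᵐ[μ] toMeasurable μ (range f) :=
    ae_eq_of_subset_of_measure_ge (hsub.trans (subset_toMeasurable _ _))
      (by rwa [measure_toMeasurable]) hB.nullMeasurableSet (measure_ne_top _ _)
  refine ⟨_, hB, ?_⟩
  exact (eventuallyLE_antisymm_iff.2 ⟨(subset_toMeasurable μ (range f)).eventuallyLE.trans h1.symm.le,
    hsub.eventuallyLE⟩)

/-! ### Universally measurable functions and the one-step Markov property -/

section Markov

variable {S Ω E : Type*} [MeasurableSpace S] [MeasurableSpace E] {mΩ : MeasurableSpace Ω}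

lemma UniversallyMeasurable.iSup {f : ℕ → S → ℝ≥0∞} (hf : ∀ n, UniversallyMeasurable (f n)) :
    UniversallyMeasurable fun x => ⨆ n, f n x := fun μ => AEMeasurable.iSup fun n => hf n μ

lemma UniversallyMeasurable.add {f g : S → ℝ≥0∞} (hf : UniversallyMeasurable f)
    (hg : UniversallyMeasurable g) : UniversallyMeasurable fun x => f x + g x :=
  fun μ => (hf μ).add (hg μ)

lemma UniversallyMeasurable.const_mul {f : S → ℝ≥0∞} (hf : UniversallyMeasurable f) (c : ℝ≥0∞) :
    UniversallyMeasurable fun x => c * f x := fun μ => (hf μ).const_mul c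

lemma UniversallyMeasurable.indicator {f : S → ℝ≥0∞} (hf : UniversallyMeasurable f) {Γ : Set S}
    (hΓ : MeasurableSet Γ) : UniversallyMeasurable (Γ.indicator f) := fun μ => (hf μ).indicator hΓ

variable {P : S → Measure Ω}

/-- If the probabilities of `Φ`-events are universally measurable in the starting point, so are the
expectations of nonnegative measurable functions of `Φ`. -/
lemma UniversallyMeasurable.lintegral_comp {Φ : Ω → E} (hΦ : Measurable Φ)
    (h : ∀ B, MeasurableSet B → UniversallyMeasurable fun x => P x (Φ ⁻¹' B))
    {f : E → ℝ≥0∞} (hf : Measurable f) :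
    UniversallyMeasurable fun x => ∫⁻ ω, f (Φ ω) ∂(P x) := by
  refine Measurable.ennreal_induction
    (motive := fun f => UniversallyMeasurable fun x => ∫⁻ ω, f (Φ ω) ∂(P x)) ?_ ?_ ?_ hf
  · intro c B hB
    have : ∀ x, ∫⁻ ω, B.indicator (fun _ => c) (Φ ω) ∂(P x) = c * P x (Φ ⁻¹' B) := fun x => by
      rw [← lintegral_indicator_const (hΦ hB)]; rfl
    simp only [this]
    exact (h B hB).const_mul c
  · intro f g hfg hf hg hf' hg'
    have : ∀ x, ∫⁻ ω, (f + g) (Φ ω) ∂(P x) = ∫⁻ ω, f (Φ ω) ∂(P x) + ∫⁻ ω, g (Φ ω) ∂(P x) :=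
      fun x => lintegral_add_left (hf.comp hΦ) _
    simp only [this]
    exact hf'.add hg'
  · intro f hf hm hf'
    have : ∀ x, ∫⁻ ω, ⨆ n, f n (Φ ω) ∂(P x) = ⨆ n, ∫⁻ ω, f n (Φ ω) ∂(P x) := fun x =>
      lintegral_iSup (fun n => (hf n).comp hΦ) fun n m hnm ω => hm hnm (Φ ω)
    simp only [this]
    exact UniversallyMeasurable.iSup hf'

/-- The law of `Φ` under the mixture of the `P x` over an initial law `μ`. -/
lemma exists_mixedLaw (hP : ∀ x, IsProbabilityMeasure (P x)) {Φ : Ω → E} (hΦ : Measurable Φ)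
    (h : ∀ B, MeasurableSet B → UniversallyMeasurable fun x => P x (Φ ⁻¹' B))
    (μ : ProbabilityMeasure S) : ∃ ν : ProbabilityMeasure E,
      ∀ B, MeasurableSet B → (ν : Measure E) B = ∫⁻ x, P x (Φ ⁻¹' B) ∂(μ : Measure S) := by
  let ν : Measure E := Measure.ofMeasurable (fun B _ => ∫⁻ x, P x (Φ ⁻¹' B) ∂(μ : Measure S))
    (by simp) (by
      intro f hf hd
      rw [← lintegral_tsum fun i => h _ (hf i) μ]
      refine lintegral_congr fun x => ?_
      rw [preimage_iUnion]
      exact measure_iUnion (fun i j hij => (hd hij).preimage Φ) fun i => hΦ (hf i))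
  have hν : ∀ B, MeasurableSet B → ν B = ∫⁻ x, P x (Φ ⁻¹' B) ∂(μ : Measure S) := fun B hB =>
    Measure.ofMeasurable_apply B hB
  exact ⟨⟨ν, ⟨by rw [hν _ MeasurableSet.univ]; simp⟩⟩, hν⟩

/-- Expectations of universally measurable functions are universally measurable. -/
lemma UniversallyMeasurable.lintegral_comp' (hP : ∀ x, IsProbabilityMeasure (P x)) {Φ : Ω → E}
    (hΦ : Measurable Φ)
    (h : ∀ B, MeasurableSet B → UniversallyMeasurable fun x => P x (Φ ⁻¹' B))
    {f : E → ℝ≥0∞} (hf : UniversallyMeasurable f) :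
    UniversallyMeasurable fun x => ∫⁻ ω, f (Φ ω) ∂(P x) := by
  intro μ
  obtain ⟨ν, hν⟩ := exists_mixedLaw hP hΦ h μ
  have hfν : AEMeasurable f (ν : Measure E) := hf ν
  set N := toMeasurable (ν : Measure E) {y | f y ≠ hfν.mk f y} with hN
  have hNm : MeasurableSet N := measurableSet_toMeasurable _ _
  -- A null set of the mixture `ν` is null under `P x` for `μ`-almost every `x`, so `f` may be
  -- replaced by its Borel version there.
  have hae : ∀ᵐ x ∂(μ : Measure S), P x (Φ ⁻¹' N) = 0 := by
    refine (lintegral_eq_zero_iff' (h N hNm μ)).1 ?_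
    rw [← hν N hNm, hN, measure_toMeasurable]
    exact hfν.ae_eq_mk
  refine AEMeasurable.congr
    (UniversallyMeasurable.lintegral_comp hΦ h hfν.measurable_mk μ) ?_
  filter_upwards [hae] with x hx
  refine lintegral_congr_ae (measure_mono_null (fun ω hω => ?_) hx)
  exact subset_toMeasurable _ _ (Ne.symm hω)

variable {F : Filtration ℝ≥0 mΩ} {Y : ℝ≥0 → Ω → S} {θ : ℝ≥0 → Ω → Ω}

namespace IsMarkovProcess

variable (hM : IsMarkovProcess F Y θ P)
include hM

lemma measurable (t : ℝ≥0) : Measurable (Y t) := (hM.adapted t).mono (F.le t) le_rfl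

lemma measurable_comp {f : S → ℝ≥0∞} (hf : Measurable f) (t : ℝ≥0) :
    Measurable fun ω => f (Y t ω) := hf.comp (hM.measurable t)

lemma universallyMeasurable_preimage (t : ℝ≥0) {Γ : Set S} (hΓ : MeasurableSet Γ) :
    UniversallyMeasurable fun x => P x (Y t ⁻¹' Γ) := hM.measurable_transition t Γ hΓ

lemma aemeasurable_comp {f : S → ℝ≥0∞} (hf : UniversallyMeasurable f) (t : ℝ≥0) (x : S) :
    AEMeasurable (fun ω => f (Y t ω)) (P x) := by
  have := hM.isProbabilityMeasure x
  have := Measure.isProbabilityMeasure_map (μ := P x) (hM.measurable t).aemeasurable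
  exact (hf ⟨(P x).map (Y t), this⟩).comp_measurable (hM.measurable t)

/-- Integrate the conditional-expectation form of the Markov property over `A`. Both sides are
finite, so the real integrals lift to `ℝ≥0∞`. -/
lemma measure_inter_preimage {x : S} {t : ℝ≥0} {A : Set Ω} (hA : MeasurableSet[F t] A) (s : ℝ≥0)
    {Γ : Set S} (hΓ : MeasurableSet Γ) :
    P x (A ∩ Y (t + s) ⁻¹' Γ) = ∫⁻ ω in A, P (Y t ω) (Y s ⁻¹' Γ) ∂(P x) := by
  have := hM.isProbabilityMeasure
  have hle : ∀ ω, P (Y t ω) (Y s ⁻¹' Γ) ≤ 1 := fun ω => prob_le_one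
  have hm : MeasurableSet (Y (t + s) ⁻¹' Γ) := hM.measurable _ hΓ
  have h1 := setIntegral_condExp (F.le t) (μ := P x) ((integrable_const (1 : ℝ)).indicator hm) hA
  rw [setIntegral_congr_ae ((F.le t) _ hA) ((hM.markov x t s Γ hΓ).mono fun ω hω _ => hω),
    setIntegral_indicator hm, setIntegral_const, smul_eq_mul, mul_one, measureReal_def] at h1
  have h2 := integral_toReal (μ := (P x).restrict A)
    (hM.aemeasurable_comp (hM.measurable_transition s Γ hΓ) t x).restrict
    (ae_of_all _ fun ω => (hle ω).trans_lt ENNReal.one_lt_top)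
  rw [h2, ENNReal.toReal_eq_toReal_iff' _ (measure_ne_top _ _)] at h1
  · exact h1.symm
  · exact ((lintegral_mono hle).trans_lt (by simp)).ne

lemma setLIntegral_comp_of_measurable {x : S} {t : ℝ≥0} {A : Set Ω} (hA : MeasurableSet[F t] A)
    (s : ℝ≥0) {f : S → ℝ≥0∞} (hf : Measurable f) :
    ∫⁻ ω in A, f (Y (t + s) ω) ∂(P x) =
      ∫⁻ ω in A, (∫⁻ ω', f (Y s ω') ∂(P (Y t ω))) ∂(P x) := by
  have hum : ∀ {f : S → ℝ≥0∞}, Measurable f →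
      AEMeasurable (fun ω => ∫⁻ ω', f (Y s ω') ∂(P (Y t ω))) ((P x).restrict A) := fun hf =>
    (hM.aemeasurable_comp (UniversallyMeasurable.lintegral_comp (hM.measurable s)
      (hM.measurable_transition s) hf) t x).restrict
  refine Measurable.ennreal_induction
    (motive := fun f => ∫⁻ ω in A, f (Y (t + s) ω) ∂(P x) =
      ∫⁻ ω in A, (∫⁻ ω', f (Y s ω') ∂(P (Y t ω))) ∂(P x)) ?_ ?_ ?_ hf
  · intro c B hB
    have h1 : ∀ (r : ℝ≥0) (ν : Measure Ω),
        ∫⁻ ω, B.indicator (fun _ => c) (Y r ω) ∂ν = c * ν (Y r ⁻¹' B) := fun r ν => by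
      rw [← lintegral_indicator_const (hM.measurable r hB)]; rfl
    simp only [h1]
    rw [lintegral_const_mul'' _
      (hM.aemeasurable_comp (hM.universallyMeasurable_preimage s hB) t x).restrict,
      Measure.restrict_apply (hM.measurable _ hB), inter_comm,
      hM.measure_inter_preimage hA s hB]
  · intro f g hfg hf hg hf' hg'
    simp only [Pi.add_apply]
    rw [lintegral_add_left (hM.measurable_comp hf _), hf', hg', ← lintegral_add_left' (hum hf)]
    exact lintegral_congr fun ω => (lintegral_add_left (hM.measurable_comp hf s) _).symm
  · intro f hf hm hf'
    beta_reduce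
    rw [lintegral_iSup (fun n => hM.measurable_comp (hf n) _) fun n m hnm ω => hm hnm _]
    simp only [hf']
    rw [← lintegral_iSup' (fun n => hum (hf n))
      (ae_of_all _ fun ω n m hnm => lintegral_mono fun ω' => hm hnm _)]
    exact lintegral_congr fun ω => (lintegral_iSup (fun n => hM.measurable_comp (hf n) s)
      fun n m hnm ω => hm hnm _).symm

/-- The Markov property for universally measurable functions. -/
lemma setLIntegral_comp {x : S} {t : ℝ≥0} {A : Set Ω} (hA : MeasurableSet[F t] A)
    (s : ℝ≥0) {f : S → ℝ≥0∞} (hf : UniversallyMeasurable f) :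
    ∫⁻ ω in A, f (Y (t + s) ω) ∂(P x) =
      ∫⁻ ω in A, (∫⁻ ω', f (Y s ω') ∂(P (Y t ω))) ∂(P x) := by
  have := hM.isProbabilityMeasure
  have hprob := Measure.isProbabilityMeasure_map (μ := P x) (hM.measurable (t + s)).aemeasurable
  have hae : AEMeasurable f ((P x).map (Y (t + s))) := hf ⟨(P x).map (Y (t + s)), hprob⟩
  set N := toMeasurable ((P x).map (Y (t + s))) {y | f y ≠ hae.mk f y} with hN
  have hNm : MeasurableSet N := measurableSet_toMeasurable _ _
  have hN0 : P x (Y (t + s) ⁻¹' N) = 0 := by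
    rw [← Measure.map_apply (hM.measurable _) hNm, hN, measure_toMeasurable]
    exact hae.ae_eq_mk
  -- The set where `f` differs from its Borel version is null at time `t + s`. By the Markov
  -- property it is almost surely also null at time `s` for the process restarted at `Y t ω`.
  have hN1 : ∀ᵐ ω ∂(P x), P (Y t ω) (Y s ⁻¹' N) = 0 := by
    rw [← univ_inter (Y (t + s) ⁻¹' N),
      hM.measure_inter_preimage (@MeasurableSet.univ _ (F t)) s hNm, Measure.restrict_univ] at hN0
    exact (lintegral_eq_zero_iff'
      (hM.aemeasurable_comp (hM.universallyMeasurable_preimage s hNm) t x)).1 hN0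
  have hsub : ∀ y, f y ≠ hae.mk f y → y ∈ N := fun y hy => subset_toMeasurable _ _ hy
  rw [lintegral_congr_ae (ae_restrict_of_ae (measure_mono_null
    (fun ω (hω : ¬ f (Y (t + s) ω) = hae.mk f (Y (t + s) ω)) => hsub _ hω) hN0)),
    hM.setLIntegral_comp_of_measurable hA s hae.measurable_mk]
  refine lintegral_congr_ae (ae_restrict_of_ae ?_)
  filter_upwards [hN1] with ω hω
  exact lintegral_congr_ae (measure_mono_null (fun ω' hω' => hsub _ (Ne.symm hω')) hω)

end IsMarkovProcess

end Markov

/-! ### The Markov property for path events -/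

section Shift

variable {S Ω : Type*} [MeasurableSpace S] {mΩ : MeasurableSpace Ω} {P : S → Measure Ω}
  {F : Filtration ℝ≥0 mΩ} {Y : ℝ≥0 → Ω → S} {θ : ℝ≥0 → Ω → Ω}

/-- The event `B` satisfies the Markov property
`P_x(A ∩ θ_s⁻¹ B) = E_x[1_A P_{Y_s}(B)]` for all `A ∈ ℱ_s`. -/
structure IsMarkovEvent (F : Filtration ℝ≥0 mΩ) (Y : ℝ≥0 → Ω → S) (θ : ℝ≥0 → Ω → Ω)
    (P : S → Measure Ω) (B : Set Ω) : Prop where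
  measurableSet : MeasurableSet B
  universallyMeasurable : UniversallyMeasurable fun y => P y B
  measure_inter : ∀ x s A, MeasurableSet[F s] A →
    P x (A ∩ θ s ⁻¹' B) = ∫⁻ ω in A, P (Y s ω) B ∂(P x)

namespace IsMarkovProcess

variable (hM : IsMarkovProcess F Y θ P)
include hM

lemma apply_shift (s t : ℝ≥0) (ω : Ω) : Y s (θ t ω) = Y (t + s) ω := congrFun (hM.shift s t) ω

lemma isMarkovEvent_univ : IsMarkovEvent F Y θ P univ := by
  have := hM.isProbabilityMeasure
  refine ⟨MeasurableSet.univ, fun μ => ?_, fun x s A hA => by simp⟩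
  simp only [measure_univ]
  exact aemeasurable_const

lemma isMarkovEvent_compl {B : Set Ω} (hB : IsMarkovEvent F Y θ P B) :
    IsMarkovEvent F Y θ P Bᶜ := by
  have := hM.isProbabilityMeasure
  have hc : ∀ y, P y Bᶜ = 1 - P y B := fun y => prob_compl_eq_one_sub hB.measurableSet
  refine ⟨hB.measurableSet.compl, fun μ => ?_, fun x s A hA => ?_⟩
  · simp only [hc]
    exact aemeasurable_const.sub (hB.universallyMeasurable μ)
  · have hsub : A ∩ θ s ⁻¹' Bᶜ = A \ (A ∩ θ s ⁻¹' B) := by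
      rw [preimage_compl, sdiff_self_inter]; rfl
    simp only [hc]
    rw [hsub, measure_sdiff inter_subset_left
      (((F.le s) _ hA).inter (hM.measurable_shift s hB.measurableSet)).nullMeasurableSet
      (measure_ne_top _ _), hB.measure_inter x s A hA, lintegral_sub'
      (hM.aemeasurable_comp hB.universallyMeasurable s x).restrict _
      (ae_of_all _ fun ω => prob_le_one)]
    · simp
    · exact ((lintegral_mono fun ω => prob_le_one).trans_lt (by simp)).ne

lemma isMarkovEvent_iUnion {B : ℕ → Set Ω} (hd : Pairwise (Function.onFun Disjoint B))
    (hB : ∀ n, IsMarkovEvent F Y θ P (B n)) : IsMarkovEvent F Y θ P (⋃ n, B n) := by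
  have hu : ∀ y, P y (⋃ n, B n) = ∑' n, P y (B n) := fun y =>
    measure_iUnion hd fun n => (hB n).measurableSet
  refine ⟨MeasurableSet.iUnion fun n => (hB n).measurableSet, fun μ => ?_, fun x s A hA => ?_⟩
  · simp only [hu]
    exact AEMeasurable.tsum fun n => (hB n).universallyMeasurable μ
  · simp only [hu]
    rw [lintegral_tsum fun n =>
      (hM.aemeasurable_comp (hB n).universallyMeasurable s x).restrict, preimage_iUnion,
      inter_iUnion, measure_iUnion]
    · exact tsum_congr fun n => (hB n).measure_inter x s A hA
    · exact fun i j hij => ((hd hij).preimage (θ s)).mono inter_subset_right inter_subset_right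
    · exact fun n => ((F.le s) _ hA).inter (hM.measurable_shift s (hB n).measurableSet)

/-- Condition first at time `s + t`, where `B` is a Markov event, then at time `s`. The function `y
↦ 1_Γ(y) P_y(B)` met on the way is only universally measurable, which is why the Markov property was
extended to such functions. -/
lemma isMarkovEvent_inter_shift {B : Set Ω} (hB : IsMarkovEvent F Y θ P B) (t : ℝ≥0) {Γ : Set S}
    (hΓ : MeasurableSet Γ) : IsMarkovEvent F Y θ P (Y t ⁻¹' Γ ∩ θ t ⁻¹' B) := by
  have hum : UniversallyMeasurable (Γ.indicator fun y => P y B) :=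
    hB.universallyMeasurable.indicator hΓ
  have hind : ∀ r, (fun ω => Γ.indicator (fun y => P y B) (Y r ω)) =
      (Y r ⁻¹' Γ).indicator fun ω => P (Y r ω) B := fun r => rfl
  have h1 : ∀ y, P y (Y t ⁻¹' Γ ∩ θ t ⁻¹' B) =
      ∫⁻ ω, Γ.indicator (fun y => P y B) (Y t ω) ∂(P y) := fun y => by
    rw [hB.measure_inter y t _ (hM.adapted t hΓ), hind, lintegral_indicator (hM.measurable t hΓ)]
  refine ⟨(hM.measurable t hΓ).inter (hM.measurable_shift t hB.measurableSet), ?_,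
    fun x s A hA => ?_⟩
  · simp only [h1]
    exact UniversallyMeasurable.lintegral_comp' hM.isProbabilityMeasure (hM.measurable t)
      (fun B hB => hM.universallyMeasurable_preimage t hB) hum
  · have hset : A ∩ θ s ⁻¹' (Y t ⁻¹' Γ ∩ θ t ⁻¹' B) =
        (A ∩ Y (s + t) ⁻¹' Γ) ∩ θ (s + t) ⁻¹' B := by
      rw [add_comm s t, hM.shift_add t s]
      ext ω
      simp only [mem_inter_iff, mem_preimage, hM.apply_shift, Function.comp_apply, add_comm t s,
        and_assoc]
    simp only [h1]
    rw [← hM.setLIntegral_comp hA t hum, hset, hB.measure_inter x (s + t), hind,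
      lintegral_indicator (hM.measurable _ hΓ),
      Measure.restrict_restrict (hM.measurable _ hΓ), inter_comm]
    exact MeasurableSet.inter (F.mono le_self_add _ hA) (hM.adapted _ hΓ)

/-- Induction on the number of observation times: the earliest one is split off, and the others
become observations of the path shifted by it. -/
lemma isMarkovEvent_biInter (I : Finset ℝ≥0) (Γ : ℝ≥0 → Set S) (hΓ : ∀ t, MeasurableSet (Γ t)) :
    IsMarkovEvent F Y θ P (⋂ t ∈ I, Y t ⁻¹' Γ t) := by
  induction hn : I.card generalizing I Γ with
  | zero =>
    rw [Finset.card_eq_zero.1 hn]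
    simpa using hM.isMarkovEvent_univ
  | succ n ih =>
    classical
    have hne : I.Nonempty := Finset.card_pos.1 (by omega)
    set t₀ := I.min' hne with ht₀
    have hle : ∀ t ∈ I, t₀ ≤ t := fun t ht => I.min'_le t ht
    have hmem : t₀ ∈ I := I.min'_mem hne
    have hcard : ((I.erase t₀).image fun t => t - t₀).card = n := by
      rw [Finset.card_image_of_injOn, Finset.card_erase_of_mem hmem, hn, Nat.add_sub_cancel]
      intro t ht t' ht' h
      exact tsub_left_inj (hle t (Finset.mem_of_mem_erase ht))
        (hle t' (Finset.mem_of_mem_erase ht')) |>.1 h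
    have := hM.isMarkovEvent_inter_shift
      (ih _ (fun t => Γ (t₀ + t)) (fun t => hΓ _) hcard) t₀ (hΓ t₀)
    convert this using 1
    ext ω
    simp only [mem_iInter, mem_preimage, mem_inter_iff, Finset.mem_image, Finset.mem_erase,
      forall_exists_index, and_imp, hM.apply_shift]
    constructor
    · intro h
      refine ⟨h _ hmem, fun t t' _ ht' htt' => ?_⟩
      rw [← htt', add_tsub_cancel_of_le (hle t' ht')]
      exact h t' ht'
    · rintro ⟨h0, h⟩ t ht
      by_cases htt : t = t₀
      · rw [htt]; exact h0
      · have := h (t - t₀) t htt ht rfl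
        rwa [add_tsub_cancel_of_le (hle t ht)] at this

end IsMarkovProcess

/-- The sigma-algebra generated by `Y r` for `r ∈ I`. -/
@[reducible] def pathSigma (Y : ℝ≥0 → Ω → S) (I : Set ℝ≥0) : MeasurableSpace Ω :=
  ⨆ r ∈ I, MeasurableSpace.comap (Y r) inferInstance

lemma pathSigma_mono (Y : ℝ≥0 → Ω → S) {I J : Set ℝ≥0} (h : I ⊆ J) :
    pathSigma Y I ≤ pathSigma Y J := biSup_mono h

lemma measurable_pathSigma (Y : ℝ≥0 → Ω → S) {I : Set ℝ≥0} {r : ℝ≥0} (hr : r ∈ I) :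
    Measurable[pathSigma Y I] (Y r) :=
  (comap_measurable (Y r)).mono
    (le_iSup₂ (f := fun r (_ : r ∈ I) => MeasurableSpace.comap (Y r) inferInstance) r hr) le_rfl

namespace IsMarkovProcess

variable (hM : IsMarkovProcess F Y θ P)
include hM

lemma pathSigma_Iic_le (t : ℝ≥0) : pathSigma Y (Iic t) ≤ F t :=
  iSup₂_le fun r hr => ((hM.adapted r).mono (F.mono hr) le_rfl).comap_le

lemma pathSigma_le (I : Set ℝ≥0) : pathSigma Y I ≤ mΩ :=
  iSup₂_le fun r _ => (hM.measurable r).comap_le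

/-- A π-λ argument: finite-dimensional cylinders form a π-system of Markov events, and Markov events
are closed under complements and disjoint countable unions. -/
lemma isMarkovEvent_of_pathSigma {I : Set ℝ≥0} {B : Set Ω} (hB : MeasurableSet[pathSigma Y I] B) :
    IsMarkovEvent F Y θ P B := by
  refine MeasurableSpace.induction_on_inter (m := pathSigma Y I)
    (C := fun B _ => IsMarkovEvent F Y θ P B)
    (generateFrom_piiUnionInter_measurableSet
      (fun r => MeasurableSpace.comap (Y r) inferInstance) I).symm
    (isPiSystem_piiUnionInter _ (fun r => @MeasurableSpace.isPiSystem_measurableSet _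
      (MeasurableSpace.comap (Y r) inferInstance)) _) ?_ ?_ ?_ ?_ B hB
  · have := hM.isMarkovEvent_compl hM.isMarkovEvent_univ
    rwa [compl_univ] at this
  · rintro _ ⟨J, -, f, hf, rfl⟩
    have hf' : ∀ r, ∃ Γ : Set S, MeasurableSet Γ ∧ (r ∈ J → Y r ⁻¹' Γ = f r) := by
      intro r
      by_cases hr : r ∈ J
      · obtain ⟨Γ, hΓ, h⟩ := hf r hr
        exact ⟨Γ, hΓ, fun _ => h⟩
      · exact ⟨∅, MeasurableSet.empty, fun h => absurd h hr⟩
    choose Γ hΓ hΓf using hf'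
    have := hM.isMarkovEvent_biInter J Γ hΓ
    rwa [iInter₂_congr fun r hr => hΓf r hr] at this
  · exact fun B _ hB => hM.isMarkovEvent_compl hB
  · exact fun B hd _ hB => hM.isMarkovEvent_iUnion hd hB

end IsMarkovProcess

/-! ### Universal completion -/

/-- The events which, for every initial law `μ`, agree on the event `G` with an event of `m`
up to an `m`-measurable null set. -/
@[reducible] def univCompletion (P : S → Measure Ω) (G : Set Ω) (m : MeasurableSpace Ω) :
    MeasurableSpace Ω where
  MeasurableSet' B := MeasurableSet[mΩ] B ∧ ∀ μ : ProbabilityMeasure S, ∃ B₁ B₂,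
    MeasurableSet[m] B₁ ∧ MeasurableSet[m] B₂ ∧ B₁ ∩ G ⊆ B ∧ B ∩ G ⊆ B₂ ∧
      ∀ᵐ x ∂(μ : Measure S), P x (B₂ \ B₁) = 0
  measurableSet_empty := ⟨@MeasurableSet.empty _ mΩ, fun μ => ⟨∅, ∅, @MeasurableSet.empty _ m,
    @MeasurableSet.empty _ m, by simp, by simp, by simp⟩⟩
  measurableSet_compl := by
    rintro B ⟨hBm, hB⟩
    refine ⟨hBm.compl, fun μ => ?_⟩
    obtain ⟨B₁, B₂, h₁, h₂, hs₁, hs₂, h0⟩ := hB μ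
    refine ⟨B₂ᶜ, B₁ᶜ, h₂.compl, h₁.compl, fun ω hω hωB => hω.1 (hs₂ ⟨hωB, hω.2⟩),
      fun ω hω hωB => hω.1 (hs₁ ⟨hωB, hω.2⟩), ?_⟩
    rwa [compl_sdiff_compl]
  measurableSet_iUnion := by
    intro B hB
    refine ⟨MeasurableSet.iUnion fun n => (hB n).1, fun μ => ?_⟩
    choose B₁ B₂ h₁ h₂ hs₁ hs₂ h0 using fun n => (hB n).2 μ
    refine ⟨⋃ n, B₁ n, ⋃ n, B₂ n, MeasurableSet.iUnion h₁, MeasurableSet.iUnion h₂, ?_, ?_, ?_⟩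
    · rw [iUnion_inter]
      exact iUnion_mono hs₁
    · rw [iUnion_inter]
      exact iUnion_mono hs₂
    · filter_upwards [ae_all_iff.2 h0] with x hx
      refine measure_mono_null ?_ (measure_iUnion_null hx)
      rintro ω ⟨hω₂, hω₁⟩
      obtain ⟨n, hn⟩ := mem_iUnion.1 hω₂
      exact mem_iUnion.2 ⟨n, hn, fun h => hω₁ (mem_iUnion.2 ⟨n, h⟩)⟩

lemma univCompletion_le (P : S → Measure Ω) (G : Set Ω) (m : MeasurableSpace Ω) :
    univCompletion P G m ≤ mΩ := fun _ hB => hB.1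

lemma ae_eq_of_sandwich {ν : Measure Ω} {G B₁ B B₂ : Set Ω} (hG : ν Gᶜ = 0) (h₁ : B₁ ∩ G ⊆ B)
    (h₂ : B ∩ G ⊆ B₂) (h0 : ν (B₂ \ B₁) = 0) : B =ᵐ[ν] B₁ := by
  rw [ae_eq_set]
  constructor
  · refine measure_mono_null (t := B₂ \ B₁ ∪ Gᶜ) (fun ω hω => ?_) (measure_union_null h0 hG)
    by_cases hωG : ω ∈ G
    · exact Or.inl ⟨h₂ ⟨hω.1, hωG⟩, hω.2⟩
    · exact Or.inr hωG
  · exact measure_mono_null (fun ω hω hωG => hω.2 (h₁ ⟨hω.1, hωG⟩)) hG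

namespace IsMarkovProcess

variable (hM : IsMarkovProcess F Y θ P)
include hM

/-- Sandwich `B` with respect to the law of `Y s` under `P x`. The gap is then null under `P (Y s
ω)` for almost every `ω`, so by the Markov property its preimage under `θ s` is null under `P x`.
The shift-stability of `G` lets the inclusions be pulled back. -/
lemma isMarkovEvent_of_univCompletion {G : Set Ω} (hG : ∀ x, P x Gᶜ = 0)
    (hθ : ∀ s, G ⊆ θ s ⁻¹' G) {I : Set ℝ≥0} {B : Set Ω}
    (hB : MeasurableSet[univCompletion P G (pathSigma Y I)] B) : IsMarkovEvent F Y θ P B := by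
  refine ⟨hB.1, fun μ => ?_, fun x s A hA => ?_⟩
  · obtain ⟨B₁, B₂, h₁, h₂, hs₁, hs₂, h0⟩ := hB.2 μ
    refine AEMeasurable.congr ((hM.isMarkovEvent_of_pathSigma h₁).universallyMeasurable μ) ?_
    filter_upwards [h0] with y hy
    exact (measure_congr (ae_eq_of_sandwich (hG y) hs₁ hs₂ hy)).symm
  · have := hM.isProbabilityMeasure x
    have hprob := Measure.isProbabilityMeasure_map (μ := P x) (hM.measurable s).aemeasurable
    obtain ⟨B₁, B₂, h₁, h₂, hs₁, hs₂, h0⟩ := hB.2 ⟨(P x).map (Y s), hprob⟩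
    replace h0 : ∀ᵐ ω ∂(P x), P (Y s ω) (B₂ \ B₁) = 0 :=
      ae_of_ae_map (hM.measurable s).aemeasurable h0
    have h₁' := hM.isMarkovEvent_of_pathSigma h₁
    have h12 := (hM.isMarkovEvent_of_pathSigma (h₂.diff h₁)).measure_inter x s univ
      (@MeasurableSet.univ _ (F s))
    rw [univ_inter, Measure.restrict_univ, lintegral_congr_ae h0, lintegral_zero] at h12
    have hae : (θ s ⁻¹' B : Set Ω) =ᵐ[P x] θ s ⁻¹' B₁ :=
      ae_eq_of_sandwich (B₂ := θ s ⁻¹' B₂) (hG x)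
        (fun ω hω => hs₁ (show θ s ω ∈ B₁ ∩ G from ⟨hω.1, hθ s hω.2⟩))
        (fun ω hω => hs₂ (show θ s ω ∈ B ∩ G from ⟨hω.1, hθ s hω.2⟩)) h12
    rw [measure_congr ((ae_eq_refl A).inter hae), h₁'.measure_inter x s A hA]
    refine lintegral_congr_ae (ae_restrict_of_ae ?_)
    filter_upwards [h0] with ω hω
    exact (measure_congr (ae_eq_of_sandwich (hG _) hs₁ hs₂ hω)).symm

/-- The Markov property for functionals measurable with respect to a sigma-algebra of
events with the Markov property. -/
lemma setLIntegral_shift {𝓖 : MeasurableSpace Ω}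
    (h𝓖 : ∀ B, MeasurableSet[𝓖] B → IsMarkovEvent F Y θ P B) {Z : Ω → ℝ≥0∞}
    (hZ : Measurable[𝓖] Z) : UniversallyMeasurable (fun y => ∫⁻ ω, Z ω ∂(P y)) ∧
      ∀ x s A, MeasurableSet[F s] A →
        ∫⁻ ω in A, Z (θ s ω) ∂(P x) = ∫⁻ ω in A, (∫⁻ ω', Z ω' ∂(P (Y s ω))) ∂(P x) := by
  have hle : 𝓖 ≤ mΩ := fun B hB => (h𝓖 B hB).measurableSet
  have hum : ∀ {Z : Ω → ℝ≥0∞}, Measurable[𝓖] Z →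
      UniversallyMeasurable (fun y => ∫⁻ ω, Z ω ∂(P y)) := fun hZ =>
    @UniversallyMeasurable.lintegral_comp S Ω Ω _ 𝓖 mΩ P id (measurable_id.mono le_rfl hle)
      (fun B hB => (h𝓖 B hB).universallyMeasurable) _ hZ
  refine ⟨hum hZ, fun x s A hA => ?_⟩
  refine @Measurable.ennreal_induction Ω 𝓖
    (fun Z => ∫⁻ ω in A, Z (θ s ω) ∂(P x) = ∫⁻ ω in A, (∫⁻ ω', Z ω' ∂(P (Y s ω))) ∂(P x))
    ?_ ?_ ?_ Z hZ
  · intro c B hB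
    have hB' := h𝓖 B hB
    have h1 : ∫⁻ ω in A, B.indicator (fun _ => c) (θ s ω) ∂(P x) =
        c * P x (A ∩ θ s ⁻¹' B) := by
      rw [inter_comm, ← Measure.restrict_apply (hM.measurable_shift s hB'.measurableSet),
        ← lintegral_indicator_const (hM.measurable_shift s hB'.measurableSet)]
      rfl
    simp only [h1, lintegral_indicator_const hB'.measurableSet]
    rw [lintegral_const_mul'' _ (hM.aemeasurable_comp hB'.universallyMeasurable s x).restrict,
      hB'.measure_inter x s A hA]
  · intro f g hfg hf hg hf' hg'
    have hf1 : Measurable[mΩ] f := hf.mono hle le_rfl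
    simp only [Pi.add_apply]
    rw [lintegral_add_left (show Measurable[mΩ] fun ω => f (θ s ω) from
      hf1.comp (hM.measurable_shift s)), hf', hg',
      ← lintegral_add_left' (hM.aemeasurable_comp (hum hf) s x).restrict]
    exact lintegral_congr fun ω => (lintegral_add_left hf1 _).symm
  · intro f hf hm hf'
    have hf1 : ∀ n, Measurable[mΩ] (f n) := fun n => (hf n).mono hle le_rfl
    beta_reduce
    rw [lintegral_iSup (fun n => show Measurable[mΩ] fun ω => f n (θ s ω) from
      (hf1 n).comp (hM.measurable_shift s)) fun n m hnm ω => hm hnm _]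
    simp only [hf']
    rw [← lintegral_iSup' (fun n => (hM.aemeasurable_comp (hum (hf n)) s x).restrict)
      (ae_of_all _ fun ω n m hnm => lintegral_mono fun ω' => hm hnm _)]
    exact lintegral_congr fun ω => (lintegral_iSup hf1 hm).symm

end IsMarkovProcess

end Shift

/-! ### Hitting events of closed sets -/

section Debut

/-- The event that the path is right-continuous. -/
def rightContPaths {S Ω : Type*} [TopologicalSpace S] (Y : ℝ≥0 → Ω → S) : Set Ω :=
  {ω | IsRightCont fun t => Y t ω}

lemma IsRadonSpace.metrizableSpace {S : Type*} [TopologicalSpace S] (h : IsRadonSpace S) :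
    TopologicalSpace.MetrizableSpace S := by
  obtain ⟨K, _, _, _, _, _, f, hf, -⟩ := h
  exact hf.metrizableSpace

lemma exists_continuous_eq_zero_iff_mem {S : Type*} [TopologicalSpace S]
    [TopologicalSpace.MetrizableSpace S] {A : Set S} (hA : IsClosed A) :
    ∃ ρ : S → ℝ, Continuous ρ ∧ ∀ y, ρ y = 0 ↔ y ∈ A := by
  let _ := TopologicalSpace.metrizableSpaceMetric S
  rcases A.eq_empty_or_nonempty with rfl | hne
  · exact ⟨fun _ => 1, continuous_const, by simp⟩
  · exact ⟨fun y => Metric.infDist y A, Metric.continuous_infDist_pt A,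
      fun y => (hA.mem_iff_infDist_zero hne).symm⟩

/-- Points of a countable grid below `t` which approximate `s` from the right. -/
lemma tendsto_grid_nhdsGE {s t : ℝ≥0} (hst : s ≤ t) :
    Tendsto (fun n : ℕ => t - (⌊(t - s) * (n + 1 : ℝ≥0)⌋₊ : ℝ≥0) / (n + 1)) atTop (𝓝[≥] s) := by
  have hle : ∀ n : ℕ, (⌊(t - s) * (n + 1 : ℝ≥0)⌋₊ : ℝ≥0) / (n + 1) ≤ t - s := fun n =>
    div_le_of_le_mul₀ (by positivity) (by positivity) (Nat.floor_le (by positivity))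
  refine tendsto_nhdsWithin_iff.2 ⟨?_, Eventually.of_forall fun n => ?_⟩
  · have h1 : Tendsto (fun n : ℕ => (⌊(t - s) * (n + 1 : ℝ≥0)⌋₊ : ℝ≥0) / (n + 1)) atTop
        (𝓝 (t - s)) := by
      have := ((tendsto_nat_floor_mul_div_atTop (R := ℝ) (NNReal.coe_nonneg (t - s))).comp
        tendsto_natCast_atTop_atTop).comp (tendsto_add_atTop_nat 1)
      rw [← NNReal.tendsto_coe]
      refine this.congr fun n => ?_
      simp only [Function.comp_apply, NNReal.coe_div, NNReal.coe_natCast, NNReal.coe_add,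
        NNReal.coe_one, Nat.cast_add, Nat.cast_one]
      congr 2
    have h2 := (tendsto_const_nhds (x := t)).sub h1
    rwa [tsub_tsub_cancel_of_le hst] at h2
  · exact le_tsub_of_add_le_left ((add_le_add_left (hle n) s).trans_eq' (by rw [add_comm]) |>.trans
      (tsub_add_cancel_of_le hst).le)

variable {S Ω : Type*} [TopologicalSpace S] [MeasurableSpace S]
  {mΩ : MeasurableSpace Ω} {P : S → Measure Ω}
  {F : Filtration ℝ≥0 mΩ} {Y : ℝ≥0 → Ω → S} {θ : ℝ≥0 → Ω → Ω}

namespace IsRightProcess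

variable (hY : IsRightProcess F Y θ P)
include hY

lemma measure_compl_rightContPaths (x : S) : P x (rightContPaths Y)ᶜ = 0 := hY.rightCont x

lemma shift_mem_rightContPaths (s : ℝ≥0) : rightContPaths Y ⊆ θ s ⁻¹' rightContPaths Y := by
  intro ω hω t
  have h := hω (s + t)
  simp only [hY.apply_shift]
  exact ContinuousWithinAt.comp (f := fun r => s + r) (g := fun r => Y r ω) h
    (continuous_const.add continuous_id).continuousWithinAt
    (fun r hr => add_le_add_right (mem_Ici.1 hr) s)

/-- The augmentation axiom can be tested one initial law at a time. For a given law, `B` differs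
from the lower set `B₁` by two null sets: one inside the gap and the non-right-continuous paths, the
other inside the latter. -/
lemma measurableSet_of_sandwich {t : ℝ≥0} {B : Set Ω}
    (h : ∀ μ : ProbabilityMeasure S, ∃ B₁ B₂, MeasurableSet[F t] B₁ ∧ MeasurableSet[F t] B₂ ∧
      B₁ ∩ rightContPaths Y ⊆ B ∧ B ∩ rightContPaths Y ⊆ B₂ ∧
      ∀ᵐ x ∂(μ : Measure S), P x (B₂ \ B₁) = 0) : MeasurableSet[F t] B := by
  rw [hY.filtration_augmented t, MeasurableSpace.measurableSet_iInf]
  intro μ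
  obtain ⟨B₁, B₂, h₁, h₂, hs₁, hs₂, h0⟩ := h μ
  have hBeq : B = (B₁ ∪ (B \ B₁)) \ (B₁ \ B) := by
    ext ω
    by_cases h : ω ∈ B <;> by_cases h' : ω ∈ B₁ <;> simp [h, h']
  have hle1 : F t ≤ F t ⊔ MeasurableSpace.generateFrom (nullSets P (μ : Measure S)) := le_sup_left
  have hle2 : MeasurableSpace.generateFrom (nullSets P (μ : Measure S)) ≤
    F t ⊔ MeasurableSpace.generateFrom (nullSets P (μ : Measure S)) := le_sup_right
  have hn1 : B \ B₁ ∈ nullSets P (μ : Measure S) := by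
    refine ⟨(B₂ \ B₁) ∪ (rightContPaths Y)ᶜ, ((F.le t _ h₂).diff (F.le t _ h₁)).union
      hY.measurableSet_rightCont.compl, fun ω hω => ?_, ?_⟩
    · by_cases hωG : ω ∈ rightContPaths Y
      · exact Or.inl ⟨hs₂ ⟨hω.1, hωG⟩, hω.2⟩
      · exact Or.inr hωG
    · filter_upwards [h0] with x hx
      exact measure_union_null hx (hY.measure_compl_rightContPaths x)
  have hn2 : B₁ \ B ∈ nullSets P (μ : Measure S) :=
    ⟨(rightContPaths Y)ᶜ, hY.measurableSet_rightCont.compl,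
      fun ω hω hωG => hω.2 (hs₁ ⟨hω.1, hωG⟩), ae_of_all _ hY.measure_compl_rightContPaths⟩
  rw [hBeq]
  exact MeasurableSet.diff (MeasurableSet.union (hle1 _ h₁)
    (hle2 _ (MeasurableSpace.measurableSet_generateFrom hn1)))
    (hle2 _ (MeasurableSpace.measurableSet_generateFrom hn2))

/-- An event which agrees with an event of `ℱ_t` on right-continuous paths belongs to `ℱ_t`. -/
lemma measurableSet_congr {t : ℝ≥0} {B B' : Set Ω} (hB' : MeasurableSet[F t] B')
    (h : ∀ ω ∈ rightContPaths Y, ω ∈ B ↔ ω ∈ B') : MeasurableSet[F t] B :=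
  hY.measurableSet_of_sandwich fun _ => ⟨B', B', hB', hB', fun ω hω => (h ω hω.2).2 hω.1,
    fun ω hω => (h ω hω.2).1 hω.1, by simp⟩

variable [BorelSpace S]

/-- On right-continuous paths the event is the preimage under the grid map `Φ` of the projection of
a Borel set `D`. That projection is analytic, hence null-measurable for the law of `Φ` under the
`μ`-mixture, and Borel approximations of it from both sides are pulled back. -/
lemma exists_mem_Ico_sandwich {A : Set S} (hA : IsClosed A) (q t : ℝ≥0)
    (μ : ProbabilityMeasure S) : ∃ B₁ B₂, MeasurableSet[pathSigma Y (Iic t)] B₁ ∧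
      MeasurableSet[pathSigma Y (Iic t)] B₂ ∧
      B₁ ∩ rightContPaths Y ⊆ {ω | ∃ s ∈ Ico q t, Y s ω ∈ A} ∧
      {ω | ∃ s ∈ Ico q t, Y s ω ∈ A} ∩ rightContPaths Y ⊆ B₂ ∧
      ∀ᵐ x ∂(μ : Measure S), P x (B₂ \ B₁) = 0 := by
  have hM := hY.toIsMarkovProcess
  have := hY.radon.metrizableSpace
  obtain ⟨ρ, hρ, hρA⟩ := exists_continuous_eq_zero_iff_mem hA
  -- The grid counts backwards from `t`, so that all observations are made no later than `t` while
  -- each `s < t` is still approached from the right.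
  let Φ : Ω → ℕ × ℕ → ℝ := fun ω p => ρ (Y (t - (p.2 : ℝ≥0) / (p.1 + 1)) ω)
  have hΦ : Measurable[pathSigma Y (Iic t)] Φ :=
    @measurable_pi_lambda _ _ _ (pathSigma Y (Iic t)) _ _ fun p =>
      hρ.measurable.comp (measurable_pathSigma Y (mem_Iic.2 tsub_le_self))
  have hΦ' : Measurable Φ := hΦ.mono (hM.pathSigma_le _) le_rfl
  let D : Set (ℝ≥0 × (ℕ × ℕ → ℝ)) := {p | p.1 ∈ Ico q t ∧
    Tendsto (fun n : ℕ => p.2 (n, ⌊(t - p.1) * (n + 1 : ℝ≥0)⌋₊)) atTop (𝓝 0)}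
  have hD : MeasurableSet D := by
    refine (measurable_fst measurableSet_Ico).inter (measurableSet_tendsto _ fun n => ?_)
    have h1 : Measurable fun z : ℕ × (ℕ × ℕ → ℝ) => z.2 (n, z.1) :=
      measurable_from_prod_countable_right fun k => measurable_pi_apply (n, k)
    have h2 : Measurable fun p : ℝ≥0 × (ℕ × ℕ → ℝ) => ⌊(t - p.1) * (n + 1 : ℝ≥0)⌋₊ :=
      Nat.measurable_floor.comp ((measurable_const.sub measurable_fst).mul_const _)
    exact h1.comp (h2.prodMk measurable_snd)
  have hmem : ∀ ω ∈ rightContPaths Y,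
      ω ∈ {ω | ∃ s ∈ Ico q t, Y s ω ∈ A} ↔ Φ ω ∈ Prod.snd '' D := by
    intro ω hω
    have hlim : ∀ s ∈ Ico q t, Tendsto (fun n : ℕ => Φ ω (n, ⌊(t - s) * (n + 1 : ℝ≥0)⌋₊)) atTop
        (𝓝 (ρ (Y s ω))) := fun s hs =>
      ((hρ.tendsto _).comp (hω s)).comp (tendsto_grid_nhdsGE hs.2.le)
    constructor
    · rintro ⟨s, hs, hsA⟩
      refine ⟨(s, Φ ω), ⟨hs, ?_⟩, rfl⟩
      have := hlim s hs
      rwa [(hρA _).2 hsA] at this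
    · rintro ⟨⟨s, φ⟩, ⟨hs, hs0⟩, rfl⟩
      exact ⟨s, hs, (hρA _).1 (tendsto_nhds_unique (hlim s hs) hs0)⟩
  have hum : ∀ B, MeasurableSet B → UniversallyMeasurable fun x => P x (Φ ⁻¹' B) := fun B hB =>
    (hM.isMarkovEvent_of_pathSigma (hΦ hB)).universallyMeasurable
  obtain ⟨ν, hν⟩ := exists_mixedLaw hY.isProbabilityMeasure hΦ' hum μ
  have hnull : NullMeasurableSet (Prod.snd '' D) (ν : Measure (ℕ × ℕ → ℝ)) :=
    nullMeasurableSet_of_analyticSet (hD.analyticSet.image_of_continuous continuous_snd)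
  obtain ⟨E₁, hE₁, hE₁m, hae₁⟩ := hnull.exists_measurable_subset_ae_eq
  obtain ⟨E₂, hE₂, hE₂m, hae₂⟩ := hnull.exists_measurable_superset_ae_eq
  refine ⟨Φ ⁻¹' E₁, Φ ⁻¹' E₂, hΦ hE₁m, hΦ hE₂m, fun ω hω => (hmem ω hω.2).2 (hE₁ hω.1),
    fun ω hω => hE₂ ((hmem ω hω.2).1 hω.1), ?_⟩
  have h0 : (ν : Measure (ℕ × ℕ → ℝ)) (E₂ \ E₁) = 0 :=
    (ae_eq_set.1 (hae₂.trans hae₁.symm)).1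
  rw [hν _ (hE₂m.diff hE₁m)] at h0
  exact (lintegral_eq_zero_iff' (hum _ (hE₂m.diff hE₁m) μ)).1 h0

lemma measurableSet_exists_mem_Ico {A : Set S} (hA : IsClosed A) (q t : ℝ≥0) :
    MeasurableSet[F t] {ω | ∃ s ∈ Ico q t, Y s ω ∈ A} :=
  hY.measurableSet_of_sandwich fun μ => by
    obtain ⟨B₁, B₂, h₁, h₂, hs⟩ := hY.exists_mem_Ico_sandwich hA q t μ
    exact ⟨B₁, B₂, hY.pathSigma_Iic_le t _ h₁, hY.pathSigma_Iic_le t _ h₂, hs⟩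

/-- The universal completion of the sigma-algebra of path events. -/
lemma measurableSet_univCompletion_exists_mem_Ico {A : Set S} (hA : IsClosed A) (q t : ℝ≥0) :
    MeasurableSet[univCompletion P (rightContPaths Y) (pathSigma Y univ)]
      {ω | ∃ s ∈ Ico q t, Y s ω ∈ A} :=
  ⟨F.le t _ (hY.measurableSet_exists_mem_Ico hA q t), fun μ => by
    obtain ⟨B₁, B₂, h₁, h₂, hs⟩ := hY.exists_mem_Ico_sandwich hA q t μ
    exact ⟨B₁, B₂, pathSigma_mono Y (subset_univ _) _ h₁, pathSigma_mono Y (subset_univ _) _ h₂,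
      hs⟩⟩

end IsRightProcess

end Debut

/-! ### The next hitting time -/

section NextHit

variable {S Ω : Type*} {Y : ℝ≥0 → Ω → S} {A : Set S}

/-- The first hitting time of `A` strictly after time `r`. -/
noncomputable def nextHit (Y : ℝ≥0 → Ω → S) (A : Set S) (r : ℝ≥0) (ω : Ω) : ℝ≥0∞ :=
  sInf ((fun t : ℝ≥0 => (t : ℝ≥0∞)) '' {t | r < t ∧ Y t ω ∈ A})

lemma hitAfter_coe (r : ℝ≥0) (ω : Ω) : hitAfter Y A (r : WithTop ℝ≥0) ω = nextHit Y A r ω := by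
  simp only [hitAfter, WithTop.coe_lt_coe]
  rfl

lemma hitAfter_lt_iff {r c : WithTop ℝ≥0} {ω : Ω} :
    hitAfter Y A r ω < c ↔ ∃ t : ℝ≥0, r < (t : WithTop ℝ≥0) ∧ Y t ω ∈ A ∧
      (t : WithTop ℝ≥0) < c := by
  rw [hitAfter, sInf_lt_iff, exists_mem_image]
  simp only [mem_ofPred_eq, and_assoc]

lemma hitAfter_le {r : WithTop ℝ≥0} {ω : Ω} {t : ℝ≥0} (hr : r < (t : WithTop ℝ≥0))
    (ht : Y t ω ∈ A) : hitAfter Y A r ω ≤ t := sInf_le ⟨t, ⟨hr, ht⟩, rfl⟩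

lemma le_hitAfter (r : WithTop ℝ≥0) (ω : Ω) : r ≤ hitAfter Y A r ω :=
  le_sInf (by rintro _ ⟨t, ⟨h, -⟩, rfl⟩; exact h.le)

lemma entryTime_lt_iff {c : WithTop ℝ≥0} {ω : Ω} :
    entryTime Y A ω < c ↔ ∃ t : ℝ≥0, Y t ω ∈ A ∧ (t : WithTop ℝ≥0) < c := by
  rw [entryTime, sInf_lt_iff, exists_mem_image]
  rfl

lemma entryTime_le {ω : Ω} {t : ℝ≥0} (ht : Y t ω ∈ A) : entryTime Y A ω ≤ t :=
  sInf_le ⟨t, ht, rfl⟩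

lemma nextHit_lt_iff {r : ℝ≥0} {c : ℝ≥0∞} {ω : Ω} :
    nextHit Y A r ω < c ↔ ∃ t : ℝ≥0, r < t ∧ Y t ω ∈ A ∧ (t : ℝ≥0∞) < c := by
  rw [nextHit, sInf_lt_iff, exists_mem_image]
  simp only [mem_ofPred_eq, and_assoc]

lemma nextHit_le {r t : ℝ≥0} {ω : Ω} (hr : r < t) (ht : Y t ω ∈ A) : nextHit Y A r ω ≤ t :=
  sInf_le ⟨t, ⟨hr, ht⟩, rfl⟩

lemma nextHit_anti {A B : Set S} (h : A ⊆ B) (r : ℝ≥0) (ω : Ω) :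
    nextHit Y B r ω ≤ nextHit Y A r ω :=
  sInf_le_sInf (image_mono fun _ ht => ⟨ht.1, h ht.2⟩)

lemma nextHit_eq_of_lt {r r' : ℝ≥0} {ω : Ω} (h : r ≤ r') (h' : (r' : ℝ≥0∞) < nextHit Y A r ω) :
    nextHit Y A r' ω = nextHit Y A r ω := by
  unfold nextHit at *
  congr 2
  ext t
  refine ⟨fun ht => ⟨h.trans_lt ht.1, ht.2⟩, fun ht => ⟨?_, ht.2⟩⟩
  exact ENNReal.coe_lt_coe.1 (h'.trans_le (sInf_le ⟨t, ht, rfl⟩))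

/-- A limit point of a closed set along a right-continuous path belongs to the set. -/
lemma mem_of_sInf_eq [TopologicalSpace S] (hA : IsClosed A) {w : ℝ≥0 → S} (hw : IsRightCont w)
    {T : Set ℝ≥0} (hT : ∀ t ∈ T, w t ∈ A) {t : ℝ≥0}
    (ht : sInf ((fun t : ℝ≥0 => (t : ℝ≥0∞)) '' T) = t) : w t ∈ A := by
  refine hA.mem_of_frequently_of_tendsto (f := w) (b := 𝓝[≥] t) ?_ (hw t)
  rw [frequently_iff]
  intro U hU
  obtain ⟨u, hu, hU⟩ := (mem_nhdsGE_iff_exists_Ico_subset' (lt_add_one t)).1 hU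
  have : sInf ((fun t : ℝ≥0 => (t : ℝ≥0∞)) '' T) < u := by
    rw [ht]; exact_mod_cast hu
  obtain ⟨_, ⟨s, hs, rfl⟩, hsu⟩ := sInf_lt_iff.1 this
  have hts : (t : ℝ≥0∞) ≤ s := ht ▸ sInf_le ⟨s, hs, rfl⟩
  exact ⟨s, hU ⟨ENNReal.coe_le_coe.1 hts, ENNReal.coe_lt_coe.1 hsu⟩, hT s hs⟩

lemma mem_of_nextHit_eq [TopologicalSpace S] (hA : IsClosed A) {ω : Ω}
    (hω : ω ∈ rightContPaths Y) {r t : ℝ≥0} (h : nextHit Y A r ω = t) : Y t ω ∈ A :=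
  mem_of_sInf_eq hA (w := fun t => Y t ω) hω (fun _ ht => ht.2) h

lemma eventually_nextHit_eq {r : ℝ≥0} {ω : Ω} (h : (r : ℝ≥0∞) < nextHit Y A r ω) :
    ∀ᶠ r' in 𝓝[>] r, nextHit Y A r' ω = nextHit Y A r ω := by
  have h1 : ∀ᶠ r' in 𝓝 r, ((r' : ℝ≥0) : ℝ≥0∞) < nextHit Y A r ω :=
    (ENNReal.continuous_coe.tendsto r).eventually (gt_mem_nhds h)
  filter_upwards [self_mem_nhdsWithin, mem_nhdsWithin_of_mem_nhds h1] with r' hr' h'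
  exact nextHit_eq_of_lt (le_of_lt hr') h'

/-- If the next visit comes before `r + c`, it also serves for `r'` close to `r`. Otherwise `c > 0`
puts it strictly after `r`, so it does not change for `r'` slightly larger, while the bound `r' + c`
increases. In the boundary case `nextHit = r + c` this works only because the inequality is not
strict. -/
lemma eventually_nextHit_le_add_iff {c : ℝ≥0} (hc : 0 < c) (r : ℝ≥0) (ω : Ω) :
    ∀ᶠ r' in 𝓝[>] r, (nextHit Y A r' ω ≤ r' + c ↔ nextHit Y A r ω ≤ r + c) := by
  by_cases h : nextHit Y A r ω < r + c
  · obtain ⟨t, hrt, htA, htc⟩ := nextHit_lt_iff.1 h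
    filter_upwards [self_mem_nhdsWithin, mem_nhdsWithin_of_mem_nhds (gt_mem_nhds hrt)]
      with r' hr' hr't
    refine iff_of_true ((nextHit_le hr't htA).trans (htc.le.trans ?_)) h.le
    gcongr
    exact le_of_lt hr'
  · have hlt : (r : ℝ≥0∞) < nextHit Y A r ω :=
      lt_of_lt_of_le (by exact_mod_cast lt_add_of_pos_right r hc) (not_lt.1 h)
    rcases (not_lt.1 h).eq_or_lt with h' | h'
    · filter_upwards [self_mem_nhdsWithin, eventually_nextHit_eq hlt] with r' hr' he
      refine iff_of_true ?_ h'.ge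
      rw [he, ← h']
      gcongr
      exact le_of_lt hr'
    · have h1 : ∀ᶠ r' in 𝓝 r, ((r' : ℝ≥0) : ℝ≥0∞) + c < nextHit Y A r ω :=
        ((ENNReal.continuous_coe.tendsto r).add_const (c : ℝ≥0∞)).eventually (gt_mem_nhds h')
      filter_upwards [eventually_nextHit_eq hlt, mem_nhdsWithin_of_mem_nhds h1] with r' he h1
      exact iff_of_false (by rw [he]; exact not_le.2 h1) (not_le.2 h')

lemma exists_denseSeq_btwn {a b : ℝ≥0} (h : a < b) :
    ∃ n, a < TopologicalSpace.denseSeq ℝ≥0 n ∧ TopologicalSpace.denseSeq ℝ≥0 n < b := by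
  obtain ⟨_, ⟨n, rfl⟩, hn⟩ := (TopologicalSpace.denseRange_denseSeq ℝ≥0).exists_between h
  exact ⟨n, hn⟩

variable [TopologicalSpace S] [MeasurableSpace S] [BorelSpace S] {mΩ : MeasurableSpace Ω}
  {P : S → Measure Ω} {F : Filtration ℝ≥0 mΩ} {θ : ℝ≥0 → Ω → Ω}

-- A visit after `r` and before `c` can be enclosed between two members of a countable dense set,
-- which gives a countable union of rectangles.
omit [TopologicalSpace S] [MeasurableSpace S] [BorelSpace S] in
lemma measurable_nextHit {𝓖 : MeasurableSpace Ω}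
    (h : ∀ q t : ℝ≥0, MeasurableSet[𝓖] {ω | ∃ s ∈ Ico q t, Y s ω ∈ A}) :
    Measurable fun p : ℝ≥0 × Ω => nextHit Y A p.1 p.2 := by
  refine measurable_of_Iio fun c => ?_
  have : (fun p : ℝ≥0 × Ω => nextHit Y A p.1 p.2) ⁻¹' Iio c = ⋃ (n : ℕ) (m : ℕ)
      (_ : (TopologicalSpace.denseSeq ℝ≥0 m : ℝ≥0∞) ≤ c),
      Iio (TopologicalSpace.denseSeq ℝ≥0 n) ×ˢ
        {ω | ∃ s ∈ Ico (TopologicalSpace.denseSeq ℝ≥0 n) (TopologicalSpace.denseSeq ℝ≥0 m),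
          Y s ω ∈ A} := by
    ext ⟨r, ω⟩
    simp only [mem_preimage, mem_Iio, nextHit_lt_iff, mem_iUnion, mem_prod, exists_prop]
    constructor
    · rintro ⟨t, hrt, htA, htc⟩
      obtain ⟨u, htu, huc⟩ := ENNReal.lt_iff_exists_nnreal_btwn.1 htc
      obtain ⟨n, hn⟩ := exists_denseSeq_btwn hrt
      obtain ⟨m, hm⟩ := exists_denseSeq_btwn (ENNReal.coe_lt_coe.1 htu)
      exact ⟨n, m, (ENNReal.coe_lt_coe.2 hm.2).le.trans huc.le, hn.1, t, ⟨hn.2.le, hm.1⟩, htA⟩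
    · rintro ⟨n, m, hm, hrn, t, ht, htA⟩
      exact ⟨t, hrn.trans_le ht.1, htA, (ENNReal.coe_lt_coe.2 ht.2).trans_le hm⟩
  rw [this]
  exact MeasurableSet.iUnion fun n => MeasurableSet.iUnion fun m => MeasurableSet.iUnion fun _ =>
    measurableSet_Iio.prod (h _ _)

lemma measurable_comp_countable {ι E Ω : Type*} [Countable ι] [MeasurableSpace ι]
    [MeasurableSingletonClass ι] [MeasurableSpace E] {m : MeasurableSpace Ω} {k : Ω → ι}
    (hk : Measurable k) {f : ι → Ω → E} (hf : ∀ i, Measurable (f i)) :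
    Measurable fun ω => f (k ω) ω :=
  (measurable_from_prod_countable_left (f := fun z : Ω × ι => f z.2 z.1) hf).comp
    (measurable_id.prodMk hk)

namespace IsMarkovProcess

omit [TopologicalSpace S] [BorelSpace S] in
lemma nextHit_shift (hM : IsMarkovProcess F Y θ P) (r s : ℝ≥0) (ω : Ω) :
    nextHit Y A (s + r) ω = s + nextHit Y A r (θ s ω) := by
  refine le_antisymm (le_of_forall_gt fun c hc => ?_) (le_of_forall_gt fun c hc => ?_)
  · obtain ⟨t, hrt, htA, htc⟩ := nextHit_lt_iff.1 (lt_tsub_iff_left.2 hc)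
    rw [hM.apply_shift] at htA
    refine nextHit_lt_iff.2 ⟨s + t, by gcongr, htA, ?_⟩
    rw [ENNReal.coe_add]
    exact lt_tsub_iff_left.1 htc
  · obtain ⟨t, hrt, htA, htc⟩ := nextHit_lt_iff.1 hc
    have hst : s ≤ t := le_self_add.trans hrt.le
    refine lt_of_le_of_lt ?_ htc
    calc (s : ℝ≥0∞) + nextHit Y A r (θ s ω) ≤ s + ((t - s : ℝ≥0) : ℝ≥0∞) := by
          gcongr
          refine nextHit_le (lt_tsub_iff_left.2 hrt) ?_
          rwa [hM.apply_shift, add_tsub_cancel_of_le hst]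
      _ = t := by rw [← ENNReal.coe_add, add_tsub_cancel_of_le hst]

end IsMarkovProcess

/-! ### Hitting times of closed sets as stopping times -/

namespace IsRightProcess

variable (hY : IsRightProcess F Y θ P)
include hY

omit [BorelSpace S] in
lemma isRightContinuous : F.IsRightContinuous := by
  refine ⟨fun t => ?_⟩
  rw [Filtration.rightCont_eq, hY.filtration_rightCont t]
  exact le_iInf fun u => iInf₂_le u.1 u.2

omit [BorelSpace S] in
lemma isStoppingTime_of_lt {τ : Ω → WithTop ℝ≥0}
    (h : ∀ t : ℝ≥0, MeasurableSet[F t] {ω | τ ω < t}) : IsStoppingTime F τ :=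
  have := hY.isRightContinuous
  isStoppingTime_of_measurableSet_lt_of_isRightContinuous h

lemma isStoppingTime_entryTime (hA : IsClosed A) : IsStoppingTime F (entryTime Y A) := by
  refine hY.isStoppingTime_of_lt fun t => ?_
  convert hY.measurableSet_exists_mem_Ico hA 0 t using 1
  ext ω
  refine entryTime_lt_iff.trans ⟨?_, ?_⟩
  · rintro ⟨s, hs, hst⟩
    exact ⟨s, ⟨zero_le, WithTop.coe_lt_coe.1 hst⟩, hs⟩
  · rintro ⟨s, hst, hs⟩
    exact ⟨s, hs, WithTop.coe_lt_coe.2 hst.2⟩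

lemma isStoppingTime_hitAfter (hA : IsClosed A) {τ : Ω → WithTop ℝ≥0} (hτ : IsStoppingTime F τ) :
    IsStoppingTime F fun ω => hitAfter Y A (τ ω) ω := by
  refine hY.isStoppingTime_of_lt fun t => ?_
  have : {ω | hitAfter Y A (τ ω) ω < t} = ⋃ (n : ℕ) (_ : TopologicalSpace.denseSeq ℝ≥0 n ≤ t),
      {ω | τ ω < TopologicalSpace.denseSeq ℝ≥0 n} ∩
        {ω | ∃ s ∈ Ico (TopologicalSpace.denseSeq ℝ≥0 n) t, Y s ω ∈ A} := by
    ext ω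
    simp only [mem_ofPred_eq, hitAfter_lt_iff, mem_iUnion, mem_inter_iff, exists_prop]
    constructor
    · rintro ⟨s, hs, hsA, hst⟩
      obtain ⟨r, hr⟩ := WithTop.ne_top_iff_exists.1 hs.ne_top
      rw [← hr] at hs ⊢
      obtain ⟨n, hn⟩ := exists_denseSeq_btwn (WithTop.coe_lt_coe.1 hs)
      rw [WithTop.coe_lt_coe] at hst
      exact ⟨n, (hn.2.trans hst).le, WithTop.coe_lt_coe.2 hn.1, s, ⟨hn.2.le, hst⟩, hsA⟩
    · rintro ⟨n, -, hn, s, hs, hsA⟩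
      exact ⟨s, hn.trans_le (WithTop.coe_le_coe.2 hs.1), hsA, WithTop.coe_lt_coe.2 hs.2⟩
  rw [this]
  exact MeasurableSet.iUnion fun n => MeasurableSet.iUnion fun hn =>
    MeasurableSet.inter (F.mono hn _ (hτ.measurableSet_lt _))
      (hY.measurableSet_exists_mem_Ico hA _ _)

/-- The event that a right process sits in a closed set at a stopping time. -/
lemma measurableSet_lt_and_mem (hA : IsClosed A) {τ : Ω → WithTop ℝ≥0} (hτ : IsStoppingTime F τ)
    (t : ℝ≥0) : MeasurableSet[F t] {ω | ∃ s < t, τ ω = s ∧ Y s ω ∈ A} := by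
  have := hY.radon.metrizableSpace
  obtain ⟨ρ, hρ, hρA⟩ := exists_continuous_eq_zero_iff_mem hA
  -- The time `τ` capped at `t` is known at time `t`. The default `0` is never used, as `τ` is
  -- finite in the first branch.
  let σ : Ω → ℝ≥0 := fun ω => if τ ω < t then (τ ω).untopD 0 else t
  have hσ : Measurable[F t] σ := by
    refine measurable_of_Iio (mδ := F t) fun u => ?_
    have : σ ⁻¹' Iio u = {ω | τ ω < (min u t : ℝ≥0)} ∪ ({ω | t < u} ∩ {ω | τ ω < t}ᶜ) := by
      ext ω
      simp only [σ, mem_preimage, mem_Iio, mem_union, mem_inter_iff, mem_compl_iff, mem_ofPred_eq]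
      by_cases h : τ ω < t
      · obtain ⟨r, hr⟩ := WithTop.ne_top_iff_exists.1 h.ne_top
        rw [if_pos h, or_iff_left fun h' => h'.2 h, ← hr, WithTop.untopD_coe, WithTop.coe_lt_coe,
          lt_min_iff, and_iff_left]
        rwa [← hr, WithTop.coe_lt_coe] at h
      · rw [if_neg h, or_iff_right fun h' => h (h'.trans_le
          (WithTop.coe_le_coe.2 (min_le_right u t)))]
        exact (and_iff_left h).symm
    rw [this]
    exact MeasurableSet.union (F.mono (min_le_right u t) _ (hτ.measurableSet_lt _))
      (MeasurableSet.inter (@MeasurableSet.const _ (F t) (t < u)) (hτ.measurableSet_lt t).compl)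
  -- For each `n` the random grid point takes countably many values, all at most `t`, so evaluating
  -- the process there needs no joint measurability in time and `ω`.
  have hk : ∀ n : ℕ, Measurable[F t] fun ω =>
      ρ (Y (t - (⌊(t - σ ω) * (n + 1 : ℝ≥0)⌋₊ : ℝ≥0) / (n + 1)) ω) := by
    intro n
    have h2 : Measurable[F t] fun ω => ⌊(t - σ ω) * (n + 1 : ℝ≥0)⌋₊ :=
      Nat.measurable_floor.comp ((measurable_const.sub hσ).mul_const _)
    exact measurable_comp_countable h2
      (f := fun k ω => ρ (Y (t - (k : ℝ≥0) / (n + 1)) ω)) fun k =>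
        hρ.measurable.comp ((hY.adapted _).mono (F.mono tsub_le_self) le_rfl)
  refine hY.measurableSet_congr (MeasurableSet.inter (hτ.measurableSet_lt t)
    (measurableSet_tendsto (𝓝 (0 : ℝ)) (l := atTop) hk)) fun ω hω => ?_
  simp only [mem_inter_iff, mem_ofPred_eq]
  by_cases h : τ ω < t
  · obtain ⟨r, hr⟩ := WithTop.ne_top_iff_exists.1 h.ne_top
    have hσr : σ ω = r := by simp only [σ, if_pos h]; rw [← hr]; rfl
    rw [← hr, WithTop.coe_lt_coe] at h
    have hlim : Tendsto (fun n : ℕ => ρ (Y (t - (⌊(t - r) * (n + 1 : ℝ≥0)⌋₊ : ℝ≥0) / (n + 1)) ω))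
        atTop (𝓝 (ρ (Y r ω))) := ((hρ.tendsto _).comp (hω r)).comp (tendsto_grid_nhdsGE h.le)
    rw [← hr, hσr]
    constructor
    · rintro ⟨s, hst, hs, hsA⟩
      rw [WithTop.coe_inj] at hs
      subst hs
      rw [(hρA _).2 hsA] at hlim
      exact ⟨WithTop.coe_lt_coe.2 h, hlim⟩
    · rintro ⟨-, h0⟩
      exact ⟨r, h, rfl, (hρA _).1 (tendsto_nhds_unique hlim h0)⟩
  · refine iff_of_false ?_ fun h' => h h'.1
    rintro ⟨s, hst, hs, -⟩
    exact h (hs ▸ WithTop.coe_lt_coe.2 hst)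

end IsRightProcess

end NextHit

/-! ### The strong Markov property at a point -/

section StrongMarkov

lemma setLIntegral_exp_neg_Ioi_zero : ∫⁻ u in Ioi (0 : ℝ), ENNReal.ofReal (Real.exp (-u)) = 1 := by
  rw [← ofReal_integral_eq_lintegral_ofReal (integrableOn_exp_neg_Ioi 0)
    (ae_of_all _ fun u => (Real.exp_pos _).le), integral_exp_neg_Ioi_zero, ENNReal.ofReal_one]

lemma aemeasurable_comp_countable {ι E Ω : Type*} [Countable ι] [MeasurableSpace ι]
    [MeasurableSingletonClass ι] [MeasurableSpace E] {m : MeasurableSpace Ω} {μ : Measure Ω}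
    {k : Ω → ι} (hk : Measurable k) {f : ι → Ω → E} (hf : ∀ i, AEMeasurable (f i) μ) :
    AEMeasurable (fun ω => f (k ω) ω) μ := by
  refine ⟨fun ω => (hf (k ω)).mk _ ω, measurable_comp_countable hk fun i => (hf i).measurable_mk, ?_⟩
  filter_upwards [ae_all_iff.2 fun i => (hf i).ae_eq_mk] with ω hω
  exact hω (k ω)

variable {S Ω : Type*} [TopologicalSpace S] [MeasurableSpace S]
  {mΩ : MeasurableSpace Ω} {P : S → Measure Ω}
  {F : Filtration ℝ≥0 mΩ} {Y : ℝ≥0 → Ω → S} {θ : ℝ≥0 → Ω → Ω} {h : ℝ≥0 → Ω → ℝ≥0∞}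

/-- The universal completion of the sigma-algebra of path events. -/
@[reducible] def pathEvents (P : S → Measure Ω) (Y : ℝ≥0 → Ω → S) : MeasurableSpace Ω :=
  univCompletion P (rightContPaths Y) (pathSigma Y univ)

lemma pathEvents_le : pathEvents P Y ≤ mΩ := univCompletion_le _ _ _

/-- `h r` is the functional `h 0` of the path shifted by `r`, with values in `[0, 1]`. -/
structure IsPathFunctional (P : S → Measure Ω) (Y : ℝ≥0 → Ω → S) (θ : ℝ≥0 → Ω → Ω)
    (h : ℝ≥0 → Ω → ℝ≥0∞) : Prop where
  measurable_uncurry : @Measurable _ _ (@Prod.instMeasurableSpace _ _ _ (pathEvents P Y)) _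
    fun p : ℝ≥0 × Ω => h p.1 p.2
  le_one : ∀ r ω, h r ω ≤ 1
  shift : ∀ r s ω, h r (θ s ω) = h (s + r) ω

/-- The average of `h (s + u / α)` over an exponential time `u`. -/
noncomputable def expAverage (h : ℝ≥0 → Ω → ℝ≥0∞) (α : ℝ) (s : ℝ≥0) (ω : Ω) : ℝ≥0∞ :=
  ∫⁻ u in Ioi (0 : ℝ), ENNReal.ofReal (Real.exp (-u)) * h (s + (u / α).toNNReal) ω

/-- The part of the average of `h (u / α)` over an exponential time `u` with `u / α > s`. -/
noncomputable def expTail (h : ℝ≥0 → Ω → ℝ≥0∞) (α : ℝ) (s : ℝ≥0) (ω : Ω) : ℝ≥0∞ :=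
  ∫⁻ u in Ioi (α * s), ENNReal.ofReal (Real.exp (-u)) * h (u / α).toNNReal ω

lemma expAverage_zero {Ω : Type*} (h : ℝ≥0 → Ω → ℝ≥0∞) (α : ℝ) (ω : Ω) :
    expAverage h α 0 ω = expTail h α 0 ω := by
  simp [expAverage, expTail]

namespace IsPathFunctional

variable (hh : IsPathFunctional P Y θ h)
include hh

lemma measurable_uncurry' : Measurable fun p : ℝ≥0 × Ω => h p.1 p.2 :=
  hh.measurable_uncurry.mono (sup_le_sup le_rfl (MeasurableSpace.comap_mono pathEvents_le)) le_rfl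

lemma measurable_left (ω : Ω) : Measurable fun r => h r ω :=
  hh.measurable_uncurry'.comp (measurable_id.prodMk measurable_const)

lemma measurable_integrand (α : ℝ) (s : ℝ≥0) (ω : Ω) :
    Measurable fun u : ℝ => ENNReal.ofReal (Real.exp (-u)) * h (s + (u / α).toNNReal) ω :=
  (by fun_prop : Measurable fun u : ℝ => ENNReal.ofReal (Real.exp (-u))).mul
    ((hh.measurable_left ω).comp (by fun_prop))

lemma integrand_le (α : ℝ) (s : ℝ≥0) (ω : Ω) (u : ℝ) :
    ENNReal.ofReal (Real.exp (-u)) * h (s + (u / α).toNNReal) ω ≤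
      ENNReal.ofReal (Real.exp (-u)) := by
  simpa using mul_le_mul_right (hh.le_one (s + (u / α).toNNReal) ω)
    (ENNReal.ofReal (Real.exp (-u)))

lemma expAverage_le_one (α : ℝ) (s : ℝ≥0) (ω : Ω) : expAverage h α s ω ≤ 1 :=
  (lintegral_mono fun u => hh.integrand_le α s ω u).trans_eq setLIntegral_exp_neg_Ioi_zero

lemma measurable_expAverage_zero (α : ℝ) : Measurable[pathEvents P Y] (expAverage h α 0) := by
  refine @Measurable.lintegral_prod_right' Ω ℝ (pathEvents P Y) _ (volume.restrict (Ioi 0)) _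
    (fun p => ENNReal.ofReal (Real.exp (-p.2)) * h (0 + (p.2 / α).toNNReal) p.1) ?_
  have h2 : @Measurable (Ω × ℝ) ℝ (@Prod.instMeasurableSpace _ _ (pathEvents P Y) _) _ Prod.snd :=
    measurable_snd
  refine Measurable.mul (h2.neg.exp.ennreal_ofReal) (hh.measurable_uncurry.comp
    (g := fun p : ℝ≥0 × Ω => h p.1 p.2) (f := fun p : Ω × ℝ => (0 + (p.2 / α).toNNReal, p.1)) ?_)
  exact Measurable.prodMk (measurable_const.add (h2.div_const α).real_toNNReal) measurable_fst

lemma measurable_expAverage_uncurry (α : ℝ) :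
    Measurable fun p : ℝ≥0 × Ω => expAverage h α p.1 p.2 := by
  refine Measurable.lintegral_prod_right' (f := fun p : (ℝ≥0 × Ω) × ℝ =>
    ENNReal.ofReal (Real.exp (-p.2)) * h (p.1.1 + (p.2 / α).toNNReal) p.1.2) ?_
  refine Measurable.mul (by fun_prop) (hh.measurable_uncurry'.comp
    (f := fun p : (ℝ≥0 × Ω) × ℝ => (p.1.1 + (p.2 / α).toNNReal, p.1.2)) ?_)
  exact Measurable.prodMk (by fun_prop) (by fun_prop)

lemma expAverage_shift (α : ℝ) (s : ℝ≥0) (ω : Ω) :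
    expAverage h α 0 (θ s ω) = expAverage h α s ω := by
  simp only [expAverage, hh.shift, zero_add]

/-- Memorylessness of the exponential law, in the form of the substitution `u ↦ u + α * s`. -/
lemma expTail_eq {α : ℝ} (hα : 0 < α) (s : ℝ≥0) (ω : Ω) :
    expTail h α s ω = ENNReal.ofReal (Real.exp (-(α * s))) * expAverage h α s ω := by
  have hmp := measurePreserving_add_right (volume : Measure ℝ) (α * s)
  have hpre : (fun u : ℝ => u + α * s) ⁻¹' Ioi (α * s) = Ioi 0 := by ext u; simp
  have hm : Measurable fun u : ℝ => ENNReal.ofReal (Real.exp (-u)) * h (u / α).toNNReal ω := by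
    simpa using hh.measurable_integrand α 0 ω
  rw [expTail, ← hmp.setLIntegral_comp_preimage measurableSet_Ioi hm, hpre, expAverage,
    ← lintegral_const_mul _ (hh.measurable_integrand α s ω)]
  refine setLIntegral_congr_fun measurableSet_Ioi fun u hu => ?_
  have h1 : ((u + α * s) / α).toNNReal = s + (u / α).toNNReal := by
    rw [add_div, mul_div_cancel_left₀ _ hα.ne', add_comm,
      Real.toNNReal_add s.coe_nonneg (div_nonneg (le_of_lt hu) hα.le), Real.toNNReal_coe]
  rw [h1, ← mul_assoc, ← ENNReal.ofReal_mul (Real.exp_pos _).le, ← Real.exp_add, neg_add, add_comm]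

lemma tendsto_expTail {α : ℝ} (hα : 0 < α) (s : ℝ≥0) (ω : Ω) :
    Tendsto (fun t => expTail h α t ω) (𝓝[≥] s) (𝓝 (expTail h α s ω)) := by
  have hm : Measurable fun u : ℝ => ENNReal.ofReal (Real.exp (-u)) * h (u / α).toNNReal ω := by
    simpa using hh.measurable_integrand α 0 ω
  simp only [expTail, ← lintegral_indicator measurableSet_Ioi]
  refine tendsto_lintegral_filter_of_dominated_convergence
    ((Ioi 0).indicator fun u => ENNReal.ofReal (Real.exp (-u)))
    (Eventually.of_forall fun t => hm.indicator measurableSet_Ioi) ?_ ?_ (ae_of_all _ fun u => ?_)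
  · refine Eventually.of_forall fun t => ae_of_all _ fun u => ?_
    refine (indicator_le_indicator_of_subset (Ioi_subset_Ioi (by positivity))
      (fun _ => zero_le) u).trans (indicator_le_indicator ?_)
    simpa using hh.integrand_le α 0 ω u
  · rw [lintegral_indicator measurableSet_Ioi, setLIntegral_exp_neg_Ioi_zero]
    exact ENNReal.one_ne_top
  · refine tendsto_const_nhds.congr' ?_
    by_cases hu : α * s < u
    · have h1 : ∀ᶠ t : ℝ≥0 in 𝓝 s, α * t < u :=
        (by fun_prop : Continuous fun t : ℝ≥0 => α * (t : ℝ)).tendsto s |>.eventually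
          (gt_mem_nhds hu)
      filter_upwards [mem_nhdsWithin_of_mem_nhds h1] with t ht
      rw [indicator_of_mem (mem_Ioi.2 hu), indicator_of_mem (mem_Ioi.2 ht)]
    · filter_upwards [self_mem_nhdsWithin] with t ht
      have ht' : ¬ α * t < u := fun hlt => hu (lt_of_le_of_lt
        (mul_le_mul_of_nonneg_left (NNReal.coe_le_coe.2 ht) hα.le) hlt)
      rw [indicator_of_notMem (by simpa using hu), indicator_of_notMem (by simpa using ht')]

/-- No regularity of `h` in time is needed: up to a continuous factor, the average depends on `t`
only through the endpoint of an integral. -/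
lemma tendsto_expAverage_nhdsGE {α : ℝ} (hα : 0 < α) (s : ℝ≥0) (ω : Ω) :
    Tendsto (fun t => expAverage h α t ω) (𝓝[≥] s) (𝓝 (expAverage h α s ω)) := by
  have h1 : ∀ t, expAverage h α t ω = ENNReal.ofReal (Real.exp (α * t)) * expTail h α t ω := by
    intro t
    rw [hh.expTail_eq hα, ← mul_assoc, ← ENNReal.ofReal_mul (Real.exp_pos _).le, ← Real.exp_add,
      add_neg_cancel, Real.exp_zero, ENNReal.ofReal_one, one_mul]
  simp only [h1]
  refine ENNReal.Tendsto.mul ?_ (Or.inr ?_) (hh.tendsto_expTail hα s ω)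
    (Or.inr ENNReal.ofReal_ne_top)
  · exact ((ENNReal.continuous_ofReal.comp
      (by fun_prop : Continuous fun t : ℝ≥0 => Real.exp (α * t))).tendsto s).mono_left
          nhdsWithin_le_nhds
  · rw [hh.expTail_eq hα]
    exact ENNReal.mul_ne_top ENNReal.ofReal_ne_top
      ((hh.expAverage_le_one α s ω).trans_lt ENNReal.one_lt_top).ne

/-- As the rate grows, the exponential time tends to `0` through positive values, so only the right
limit of `h` at `s` enters. -/
lemma tendsto_expAverage_atTop {s : ℝ≥0} {ω : Ω}
    (hlim : Tendsto (fun r => h r ω) (𝓝[>] s) (𝓝 (h s ω))) :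
    Tendsto (fun n : ℕ => expAverage h (n + 1) s ω) atTop (𝓝 (h s ω)) := by
  have h1 : ∫⁻ u in Ioi (0 : ℝ), ENNReal.ofReal (Real.exp (-u)) * h s ω = h s ω := by
    rw [lintegral_mul_const _ (by fun_prop), setLIntegral_exp_neg_Ioi_zero, one_mul]
  rw [← h1]
  refine tendsto_lintegral_of_dominated_convergence (fun u => ENNReal.ofReal (Real.exp (-u)))
    (fun n => hh.measurable_integrand _ s ω) (fun n => ae_of_all _ (hh.integrand_le _ s ω))
    (by rw [setLIntegral_exp_neg_Ioi_zero]; exact ENNReal.one_ne_top) ?_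
  filter_upwards [ae_restrict_mem measurableSet_Ioi] with u hu
  refine ENNReal.Tendsto.const_mul (hlim.comp ?_) (Or.inr ENNReal.ofReal_ne_top)
  refine tendsto_nhdsWithin_iff.2 ⟨?_, Eventually.of_forall fun n => ?_⟩
  · have h2 : Tendsto (fun n : ℕ => u / ((n : ℝ) + 1)) atTop (𝓝 0) :=
      (tendsto_const_nhds (x := u)).div_atTop
        (tendsto_natCast_atTop_atTop.atTop_add tendsto_const_nhds)
    have h3 := (tendsto_const_nhds (x := s)).add ((continuous_real_toNNReal.tendsto 0).comp h2)
    simpa using h3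
  · exact lt_add_of_pos_right s (Real.toNNReal_pos.2 (div_pos hu (by positivity)))

end IsPathFunctional

namespace IsRightProcess

variable (hY : IsRightProcess F Y θ P) (hh : IsPathFunctional P Y θ h)
include hY

lemma isMarkovEvent {B : Set Ω} (hB : MeasurableSet[pathEvents P Y] B) :
    IsMarkovEvent F Y θ P B :=
  hY.isMarkovEvent_of_univCompletion hY.measure_compl_rightContPaths
    hY.shift_mem_rightContPaths hB

include hh

lemma setLIntegral_expAverage (α : ℝ) {x : S} {s : ℝ≥0} {A : Set Ω}
    (hA : MeasurableSet[F s] A) :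
    ∫⁻ ω in A, expAverage h α s ω ∂(P x) =
      ∫⁻ ω in A, (∫⁻ ω', expAverage h α 0 ω' ∂(P (Y s ω))) ∂(P x) := by
  rw [← (hY.setLIntegral_shift (fun _ => hY.isMarkovEvent) (hh.measurable_expAverage_zero α)).2
    x s A hA]
  simp only [hh.expAverage_shift]

/-- By the Markov property and memorylessness, `e^{-αt} P_t` turns the expected average into the
expected tail beyond `t`, which increases to the full average as `t ↓ 0`. This is what makes (HD2)
applicable. -/
lemma isExcessive_lintegral_expAverage {α : ℝ} (hα : 0 < α) :
    IsExcessive Y P α fun y => ∫⁻ ω, expAverage h α 0 ω ∂(P y) := by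
  have hm : ∀ t, Measurable (expAverage h α t) := fun t =>
    (hh.measurable_expAverage_uncurry α).comp (measurable_const.prodMk measurable_id)
  have key : ∀ (t : ℝ≥0) (x : S), ENNReal.ofReal (Real.exp (-(α * t))) *
      ∫⁻ ω, (∫⁻ ω', expAverage h α 0 ω' ∂(P (Y t ω))) ∂(P x) = ∫⁻ ω, expTail h α t ω ∂(P x) := by
    intro t x
    have := hY.setLIntegral_expAverage hh α (x := x) (@MeasurableSet.univ _ (F t))
    rw [Measure.restrict_univ] at this
    rw [← this, ← lintegral_const_mul _ (hm t)]
    exact lintegral_congr fun ω => (hh.expTail_eq hα t ω).symm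
  have hle : ∀ t ω, expTail h α t ω ≤ expTail h α 0 ω := fun t ω =>
    lintegral_mono_set (Ioi_subset_Ioi (by simpa using by positivity))
  refine ⟨(hY.setLIntegral_shift (fun _ => hY.isMarkovEvent)
    (hh.measurable_expAverage_zero α)).1, fun t x => ?_, fun x => ?_⟩
  · rw [key]
    simp only [expAverage_zero h]
    exact lintegral_mono (hle t)
  · have := hY.isProbabilityMeasure x
    simp only [key]
    simp only [expAverage_zero h]
    refine tendsto_lintegral_filter_of_dominated_convergence (fun _ => 1)
      (Eventually.of_forall fun t => ?_) (Eventually.of_forall fun t => ae_of_all _ fun ω => ?_)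
      (by rw [lintegral_one]; exact measure_ne_top _ _) (ae_of_all _ fun ω => ?_)
    · simp only [funext (hh.expTail_eq hα t)]
      exact (hm t).const_mul _
    · exact (hle t ω).trans ((expAverage_zero h α ω).symm.le.trans (hh.expAverage_le_one α 0 ω))
    · exact (hh.tendsto_expTail hα 0 ω).mono_left (nhdsWithin_mono _ Ioi_subset_Ici_self)

/-- The strong Markov property, in resolvent form, at a random time at which the process sits
at a fixed point `a`. -/
lemma setLIntegral_expAverage_of_eq {α : ℝ} (hα : 0 < α) {x a : S} {σ : Ω → ℝ≥0}
    (hσ : Measurable σ) {A : Set Ω} (hA : ∀ t, MeasurableSet[F t] (A ∩ {ω | σ ω < t}))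
    (ha : ∀ᵐ ω ∂(P x), ω ∈ A → Y (σ ω) ω = a) :
    ∫⁻ ω in A, expAverage h α (σ ω) ω ∂(P x) =
      P x A * ∫⁻ ω, expAverage h α 0 ω ∂(P a) := by
  have hprob := hY.isProbabilityMeasure
  set f : S → ℝ≥0∞ := fun y => ∫⁻ ω, expAverage h α 0 ω ∂(P y) with hf
  have hexc := hY.isExcessive_lintegral_expAverage hh hα
  have hAm : MeasurableSet A := by
    have : A = ⋃ n : ℕ, A ∩ {ω | σ ω < n} := by
      rw [← inter_iUnion, eq_comm, inter_eq_left]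
      exact fun ω _ => mem_iUnion.2 (exists_nat_gt (σ ω))
    rw [this]
    exact MeasurableSet.iUnion fun n => F.le _ _ (hA n)
  let k : ℕ → Ω → ℕ := fun n ω => ⌊σ ω * (n + 1)⌋₊
  have hk : ∀ n, Measurable (k n) := fun n => Nat.measurable_floor.comp (hσ.mul_const _)
  -- The right endpoint of the grid cell containing `σ`: the `+ 1` makes it exceed `σ`, so that the
  -- event of being in cell `j` is known at time `q n j`.
  let q : ℕ → ℕ → ℝ≥0 := fun n j => (j + 1) / (n + 1)
  have hq : ∀ n ω, σ ω ≤ q n (k n ω) := fun n ω => by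
    rw [le_div_iff₀ (by positivity)]
    exact (Nat.lt_floor_add_one _).le
  have hq' : ∀ n ω, q n (k n ω) ≤ σ ω + 1 / (n + 1) := fun n ω => by
    rw [div_le_iff₀ (by positivity), add_mul, one_div, inv_mul_cancel₀ (by positivity)]
    gcongr
    exact Nat.floor_le (by positivity)
  have hqlim : ∀ ω, Tendsto (fun n => q n (k n ω)) atTop (𝓝[≥] (σ ω)) := fun ω => by
    refine tendsto_nhdsWithin_iff.2 ⟨?_, Eventually.of_forall fun n => hq n ω⟩
    refine tendsto_of_tendsto_of_tendsto_of_le_of_le tendsto_const_nhds ?_ (fun n => hq n ω)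
      (fun n => hq' n ω)
    simpa using (tendsto_const_nhds (x := σ ω)).add
      (tendsto_one_div_add_atTop_nhds_zero_nat (𝕜 := ℝ≥0))
  have hfn : ∀ n, AEMeasurable (fun ω => f (Y (q n (k n ω)) ω)) ((P x).restrict A) := fun n =>
    aemeasurable_comp_countable (f := fun j ω => f (Y (q n j) ω)) (hk n) fun j =>
      (hY.aemeasurable_comp hexc.measurable _ x).restrict
  have heq : ∀ n, ∫⁻ ω in A, expAverage h α (q n (k n ω)) ω ∂(P x) =
      ∫⁻ ω in A, f (Y (q n (k n ω)) ω) ∂(P x) := by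
    intro n
    have hAeq : A = ⋃ j, A ∩ {ω | k n ω = j} := by
      rw [← inter_iUnion, eq_comm, inter_eq_left]
      exact fun ω _ => mem_iUnion.2 ⟨_, rfl⟩
    have hAj : ∀ j, MeasurableSet[F (q n j)] (A ∩ {ω | k n ω = j}) := by
      intro j
      have hset : A ∩ {ω | k n ω = j} =
          (A ∩ {ω | σ ω < q n j}) \ (A ∩ {ω | σ ω < (j / (n + 1) : ℝ≥0)}) := by
        ext ω
        have hpos : (0 : ℝ≥0) < n + 1 := by positivity
        have h1 : k n ω = j ↔ (j / (n + 1) : ℝ≥0) ≤ σ ω ∧ σ ω < q n j := by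
          rw [Nat.floor_eq_iff (by positivity), div_le_iff₀ hpos, lt_div_iff₀ hpos]
        simp only [mem_inter_iff, mem_ofPred_eq, Set.mem_sdiff, h1, not_and, not_lt]
        tauto
      rw [hset]
      exact MeasurableSet.diff (hA _) (F.mono (by simp only [q]; gcongr; simp) _ (hA _))
    have hAj' : ∀ j, MeasurableSet (A ∩ {ω | k n ω = j}) := fun j => F.le _ _ (hAj j)
    have hd : Pairwise (Function.onFun Disjoint fun j => A ∩ {ω | k n ω = j}) := by
      intro i j hij
      refine disjoint_left.2 fun ω h1 h2 => hij ?_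
      exact h1.2.symm.trans h2.2
    rw [hAeq, lintegral_iUnion hAj' hd, lintegral_iUnion hAj' hd]
    refine tsum_congr fun j => ?_
    rw [setLIntegral_congr_fun (g := expAverage h α (q n j)) (hAj' j) fun ω hω => by
        rw [show k n ω = j from hω.2],
      setLIntegral_congr_fun (f := fun ω => f (Y (q n (k n ω)) ω))
        (g := fun ω => f (Y (q n j) ω)) (hAj' j) fun ω hω => by
        simp only [show k n ω = j from hω.2]]
    exact hY.setLIntegral_expAverage hh α (hAj j)
  have hlim1 : Tendsto (fun n => ∫⁻ ω in A, expAverage h α (q n (k n ω)) ω ∂(P x)) atTop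
      (𝓝 (∫⁻ ω in A, expAverage h α (σ ω) ω ∂(P x))) := by
    refine tendsto_lintegral_of_dominated_convergence (fun _ => 1) (fun n => ?_)
      (fun n => ae_of_all _ fun ω => hh.expAverage_le_one _ _ _) ?_ (ae_of_all _ fun ω => ?_)
    · exact (hh.measurable_expAverage_uncurry α).comp
        (((measurable_from_nat (f := q n)).comp (hk n)).prodMk measurable_id)
    · simp
    · exact (hh.tendsto_expAverage_nhdsGE hα _ _).comp (hqlim ω)
  have hlim2 : Tendsto (fun n => ∫⁻ ω in A, f (Y (q n (k n ω)) ω) ∂(P x)) atTop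
      (𝓝 (∫⁻ ω in A, f a ∂(P x))) := by
    refine tendsto_lintegral_of_dominated_convergence' (fun _ => 1) hfn
      (fun n => ae_of_all _ fun ω => ?_) ?_ ?_
    · exact (lintegral_mono fun ω => hh.expAverage_le_one α 0 ω).trans (by simp)
    · simp
    · rw [ae_restrict_iff' hAm]
      -- (HD2) enters here: `f` along the path is right-continuous at `σ ω`, where its value is `f
      -- a`.
      filter_upwards [ha, hY.hd2 α f hα hexc x] with ω hωa hωf hωA
      have := (hωf (σ ω)).tendsto.comp (hqlim ω)
      rwa [hωa hωA] at this
  rw [tendsto_nhds_unique hlim1 ((tendsto_congr heq).2 hlim2), setLIntegral_const, mul_comm]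

/-- The strong Markov property at a random time at which the process sits at a fixed point `a`,
for functionals which are right-continuous at that time. -/
lemma setLIntegral_pathFunctional {x a : S} {σ : Ω → ℝ≥0}
    (hσ : Measurable σ) {A : Set Ω} (hA : ∀ t, MeasurableSet[F t] (A ∩ {ω | σ ω < t}))
    (ha : ∀ᵐ ω ∂(P x), ω ∈ A → Y (σ ω) ω = a)
    (hx : ∀ᵐ ω ∂(P x), ω ∈ A → Tendsto (fun r => h r ω) (𝓝[>] (σ ω)) (𝓝 (h (σ ω) ω)))
    (h0 : ∀ᵐ ω ∂(P a), Tendsto (fun r => h r ω) (𝓝[>] 0) (𝓝 (h 0 ω))) :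
    ∫⁻ ω in A, h (σ ω) ω ∂(P x) = P x A * ∫⁻ ω, h 0 ω ∂(P a) := by
  have hprob := hY.isProbabilityMeasure
  have hlim1 : Tendsto (fun n : ℕ => ∫⁻ ω in A, expAverage h (n + 1) (σ ω) ω ∂(P x)) atTop
      (𝓝 (∫⁻ ω in A, h (σ ω) ω ∂(P x))) := by
    refine tendsto_lintegral_of_dominated_convergence (fun _ => 1) (fun n => ?_)
      (fun n => ae_of_all _ fun ω => hh.expAverage_le_one _ _ _) (by simp) ?_
    · exact (hh.measurable_expAverage_uncurry _).comp (hσ.prodMk measurable_id)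
    · have hAm : MeasurableSet A := by
        have : A = ⋃ n : ℕ, A ∩ {ω | σ ω < n} := by
          rw [← inter_iUnion, eq_comm, inter_eq_left]
          exact fun ω _ => mem_iUnion.2 (exists_nat_gt (σ ω))
        rw [this]
        exact MeasurableSet.iUnion fun n => F.le _ _ (hA n)
      rw [ae_restrict_iff' hAm]
      filter_upwards [hx] with ω hω hωA
      exact hh.tendsto_expAverage_atTop (hω hωA)
  have hlim2 : Tendsto (fun n : ℕ => ∫⁻ ω, expAverage h (n + 1) 0 ω ∂(P a)) atTop
      (𝓝 (∫⁻ ω, h 0 ω ∂(P a))) := by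
    refine tendsto_lintegral_of_dominated_convergence (fun _ => 1)
      (fun n => (hh.measurable_expAverage_zero _).mono pathEvents_le le_rfl)
      (fun n => ae_of_all _ fun ω => hh.expAverage_le_one _ _ _) (by simp) ?_
    filter_upwards [h0] with ω hω
    exact hh.tendsto_expAverage_atTop hω
  -- The resolvent identity holds at every rate `n + 1`; both of its sides converge.
  refine tendsto_nhds_unique hlim1 ((ENNReal.Tendsto.const_mul hlim2
    (Or.inr (measure_ne_top _ _))).congr fun n => ?_)
  exact (hY.setLIntegral_expAverage_of_eq hh (by positivity) hσ hA ha).symm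

end IsRightProcess

end StrongMarkov

/-! ### Hitting finite sets of irregular points -/

section FiniteSets

variable {S Ω : Type*} [TopologicalSpace S] [MeasurableSpace S]
  {mΩ : MeasurableSpace Ω} {P : S → Measure Ω}
  {F : Filtration ℝ≥0 mΩ} {Y : ℝ≥0 → Ω → S} {θ : ℝ≥0 → Ω → Ω} {p : ℝ≥0 → Ω → Prop} {K : Set S}

/-- `p r` is the path event `p 0` shifted by `r`. -/
structure IsPathEvent (P : S → Measure Ω) (Y : ℝ≥0 → Ω → S) (θ : ℝ≥0 → Ω → Ω)
    (p : ℝ≥0 → Ω → Prop) : Prop where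
  measurableSet : @MeasurableSet _ (@Prod.instMeasurableSpace _ _ _ (pathEvents P Y))
    {q : ℝ≥0 × Ω | p q.1 q.2}
  shift : ∀ r s ω, p r (θ s ω) ↔ p (s + r) ω

open Classical in
lemma IsPathEvent.isPathFunctional (hp : IsPathEvent P Y θ p) :
    IsPathFunctional P Y θ fun r ω => if p r ω then 1 else 0 where
  measurable_uncurry := Measurable.ite hp.measurableSet measurable_const measurable_const
  le_one r ω := by split_ifs <;> simp
  shift r s ω := by simp only [hp.shift]

namespace IsRightProcess

variable (hY : IsRightProcess F Y θ P)
include hY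

/-- The strong Markov property at a stopping time at which the process sits at a fixed point `a`,
for events which are determined right after that time. -/
lemma measure_inter_pathEvent (hp : IsPathEvent P Y θ p) {x a : S} {τ : Ω → WithTop ℝ≥0}
    (hτ : IsStoppingTime F τ) {A : Set Ω} (hA : MeasurableSet[hτ.measurableSpace] A)
    (ha : ∀ ω ∈ A, ∃ s : ℝ≥0, τ ω = s ∧ Y s ω = a)
    (hx : ∀ᵐ ω ∂(P x), ∀ s : ℝ≥0, τ ω = s → ω ∈ A → ∀ᶠ r in 𝓝[>] s, (p r ω ↔ p s ω))
    (h0 : ∀ᵐ ω ∂(P a), ∀ᶠ r in 𝓝[>] 0, (p r ω ↔ p 0 ω)) :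
    P x (A ∩ {ω | ∃ s : ℝ≥0, τ ω = s ∧ p s ω}) = P x A * P a {ω | p 0 ω} := by
  classical
  -- The value `0` given to `τ = ∞` is harmless, because `τ` is finite on `A`.
  have hσ : Measurable fun ω => (τ ω).untopD 0 := hτ.measurable'.untopD 0
  have hσA : ∀ ω ∈ A, ∀ s : ℝ≥0, τ ω = s → (τ ω).untopD 0 = s := fun ω _ s hs => by rw [hs]; rfl
  have hp' : MeasurableSet {q : ℝ≥0 × Ω | p q.1 q.2} :=
    sup_le_sup le_rfl (MeasurableSpace.comap_mono pathEvents_le) _ hp.measurableSet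
  have htend : ∀ {s : ℝ≥0} {ω : Ω}, (∀ᶠ r in 𝓝[>] s, (p r ω ↔ p s ω)) →
      Tendsto (fun r => if p r ω then (1 : ℝ≥0∞) else 0) (𝓝[>] s)
        (𝓝 (if p s ω then (1 : ℝ≥0∞) else 0)) := fun h =>
    tendsto_const_nhds.congr' (h.mono fun r hr => by simp only [hr])
  have hm : ∀ s : Ω → ℝ≥0, Measurable s → MeasurableSet {ω | p (s ω) ω} := fun s hs =>
    hp'.preimage (hs.prodMk measurable_id)
  have key := hY.setLIntegral_pathFunctional hp.isPathFunctional (x := x) (a := a) hσ (A := A)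
    (fun t => ?_) (ae_of_all _ fun ω hω => ?_) ?_ (h0.mono fun ω hω => htend hω)
  · have hite : ∀ (s : Ω → ℝ≥0), (fun ω => if p (s ω) ω then (1 : ℝ≥0∞) else 0) =
        {ω | p (s ω) ω}.indicator 1 := fun s => by ext ω; simp [indicator_apply]
    rw [hite fun ω => (τ ω).untopD 0, hite fun _ => 0,
      lintegral_indicator_one (hm _ hσ), lintegral_indicator_one (hm _ measurable_const),
      Measure.restrict_apply (hm _ hσ)] at key
    rw [← key]
    congr 1
    ext ω
    constructor
    · rintro ⟨hω, s, hs, hps⟩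
      refine ⟨?_, hω⟩
      rw [mem_ofPred_eq, hσA ω hω s hs]
      exact hps
    · rintro ⟨hps, hω⟩
      obtain ⟨s, hs, -⟩ := ha ω hω
      rw [mem_ofPred_eq, hσA ω hω s hs] at hps
      exact ⟨hω, s, hs, hps⟩
  · have h1 := MeasurableSet.inter (hA.2 t) (hτ.measurableSet_lt t)
    convert h1 using 1
    ext ω
    constructor
    · rintro ⟨hω, hlt⟩
      obtain ⟨s, hs, -⟩ := ha ω hω
      rw [mem_ofPred_eq, hσA ω hω s hs] at hlt
      have h2 : τ ω < t := by rw [hs]; exact WithTop.coe_lt_coe.2 hlt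
      exact ⟨⟨hω, h2.le⟩, h2⟩
    · rintro ⟨⟨hω, -⟩, hlt⟩
      obtain ⟨s, hs, -⟩ := ha ω hω
      refine ⟨hω, ?_⟩
      rw [mem_ofPred_eq, hσA ω hω s hs]
      rw [mem_ofPred_eq, hs] at hlt
      exact WithTop.coe_lt_coe.1 hlt
  · obtain ⟨s, hs, hsa⟩ := ha ω hω
    rwa [hσA ω hω s hs]
  · filter_upwards [hx] with ω hω hωA
    obtain ⟨s, hs, hsa⟩ := ha ω hωA
    simp only [hσA ω hωA s hs]
    exact htend (hω s hs hωA)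

lemma t2Space : T2Space S :=
  have := hY.radon.metrizableSpace
  inferInstance

lemma isClosed_of_finite (hK : K.Finite) : IsClosed K :=
  have := hY.t2Space
  hK.isClosed

variable [BorelSpace S]

lemma measurable_nextHit_pathEvents (hK : IsClosed K) :
    @Measurable _ _ (@Prod.instMeasurableSpace _ _ _ (pathEvents P Y)) _
      fun q : ℝ≥0 × Ω => nextHit Y K q.1 q.2 :=
  measurable_nextHit (𝓖 := pathEvents P Y)
    fun q t => hY.measurableSet_univCompletion_exists_mem_Ico hK q t

lemma isPathEvent_nextHit_le (hK : IsClosed K) (c : ℝ≥0) :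
    IsPathEvent P Y θ fun r ω => nextHit Y K r ω ≤ r + c where
  measurableSet := by
    have h1 := hY.measurable_nextHit_pathEvents hK
    have h2 : @Measurable _ _ (@Prod.instMeasurableSpace _ _ _ (pathEvents P Y)) _
      (Prod.fst : ℝ≥0 × Ω → ℝ≥0) := measurable_fst
    exact measurableSet_le h1 (h2.coe_nnreal_ennreal.add_const _)
  shift r s ω := by
    rw [hY.nextHit_shift, ENNReal.coe_add, add_assoc]
    exact (ENNReal.add_le_add_iff_left ENNReal.coe_ne_top).symm

lemma measurableSet_mem_of_isStoppingTime (hK : IsClosed K) {τ : Ω → WithTop ℝ≥0}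
    (hτ : IsStoppingTime F τ) :
    MeasurableSet[hτ.measurableSpace] {ω | ∃ s : ℝ≥0, τ ω = s ∧ Y s ω ∈ K} := by
  have h1 := hY.measurableSet_lt_and_mem hK hτ
  refine ⟨?_, fun t => ?_⟩
  · have : {ω | ∃ s : ℝ≥0, τ ω = s ∧ Y s ω ∈ K} =
        ⋃ n : ℕ, {ω | ∃ s < (n : ℝ≥0), τ ω = s ∧ Y s ω ∈ K} := by
      ext ω
      simp only [mem_iUnion, mem_ofPred_eq]
      constructor
      · rintro ⟨s, hs⟩
        obtain ⟨n, hn⟩ := exists_nat_gt s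
        exact ⟨n, s, hn, hs⟩
      · rintro ⟨n, s, -, hs⟩
        exact ⟨s, hs⟩
    rw [this]
    exact MeasurableSet.iUnion fun n => le_iSup (fun t => F t) (n : ℝ≥0) _ (h1 n)
  -- The known events require `τ` to be strictly before a given time. Using all times `u > t` and
  -- the right-continuity of the filtration allows `τ = t`.
  · rw [hY.filtration_rightCont t, MeasurableSpace.measurableSet_iInf]
    rintro ⟨u, hu⟩
    have := MeasurableSet.inter (h1 u) (F.mono (le_of_lt hu) _ (hτ t))
    convert this using 1
    ext ω
    constructor
    · rintro ⟨⟨s, hs, hsK⟩, hle⟩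
      refine ⟨⟨s, ?_, hs, hsK⟩, hle⟩
      rw [mem_ofPred_eq, hs, WithTop.coe_le_coe] at hle
      exact hle.trans_lt hu
    · rintro ⟨⟨s, -, hs⟩, hle⟩
      exact ⟨⟨s, hs⟩, hle⟩

lemma ae_apply_zero_eq (a : S) : ∀ᵐ ω ∂(P a), Y 0 ω = a := by
  have := hY.isProbabilityMeasure a
  have hm : MeasurableSet (Y 0 ⁻¹' {a}) :=
    hY.measurable 0 (hY.isClosed_of_finite (finite_singleton a)).measurableSet
  exact (prob_compl_eq_zero_iff hm).2 (hY.normal a)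

lemma measure_inter_nextHit_le (hK : K.Finite) {c : ℝ≥0} (hc : 0 < c) {x a : S}
    {τ : Ω → WithTop ℝ≥0} (hτ : IsStoppingTime F τ) {A : Set Ω}
    (hA : MeasurableSet[hτ.measurableSpace] A)
    (ha : ∀ ω ∈ A, ∃ s : ℝ≥0, τ ω = s ∧ Y s ω = a) :
    P x (A ∩ {ω | ∃ s : ℝ≥0, τ ω = s ∧ nextHit Y K s ω ≤ s + c}) =
      P x A * P a {ω | nextHit Y K 0 ω ≤ c} := by
  rw [hY.measure_inter_pathEvent (hY.isPathEvent_nextHit_le (hY.isClosed_of_finite hK) c) hτ hA ha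
    (ae_of_all _ fun ω s _ _ => eventually_nextHit_le_add_iff hc s ω)
    (ae_of_all _ fun ω => eventually_nextHit_le_add_iff hc 0 ω)]
  simp

variable (hK : K.Finite) (hirr : ∀ a ∈ K, IsIrregularForItself Y P a)
include hK hirr

/-- Right-continuity keeps the path away from the closed set `K \ {a}` for a short time, and
irregularity keeps it from returning to `a`. -/
lemma ae_nextHit_pos {a : S} (ha : a ∈ K) : ∀ᵐ ω ∂(P a), 0 < nextHit Y K 0 ω := by
  filter_upwards [hirr a ha, hY.ae_apply_zero_eq a, hY.rightCont a] with ω h1 h2 h3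
  have hcl : IsClosed (K \ {a}) := hY.isClosed_of_finite hK.sdiff
  have hmem : (K \ {a})ᶜ ∈ 𝓝 (Y 0 ω) := hcl.isOpen_compl.mem_nhds (by rw [h2]; simp)
  obtain ⟨u, hu, hU⟩ := (mem_nhdsGE_iff_exists_Ico_subset' (zero_lt_one (α := ℝ≥0))).1
    ((h3 0).tendsto hmem)
  have h1' : 0 < nextHit Y {a} 0 ω := by
    rw [← hitAfter_coe]
    exact h1
  refine lt_of_lt_of_le (lt_min (ENNReal.coe_pos.2 hu) h1') ?_
  refine le_of_forall_gt fun c hc => ?_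
  obtain ⟨t, ht, htK, htc⟩ := nextHit_lt_iff.1 hc
  refine lt_of_le_of_lt ?_ htc
  by_cases htu : t < u
  · refine min_le_of_right_le (nextHit_le ht ?_)
    by_contra hne
    exact hU ⟨zero_le, htu⟩ ⟨htK, hne⟩
  · exact min_le_of_left_le (ENNReal.coe_le_coe.2 (not_lt.1 htu))

lemma tendsto_measure_nextHit_le {a : S} (ha : a ∈ K) :
    Tendsto (fun n : ℕ => P a {ω | nextHit Y K 0 ω ≤ ((1 / (n + 1) : ℝ≥0) : ℝ≥0∞)}) atTop
      (𝓝 0) := by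
  have := hY.isProbabilityMeasure a
  have hm : ∀ n : ℕ, MeasurableSet {ω | nextHit Y K 0 ω ≤ ((1 / (n + 1) : ℝ≥0) : ℝ≥0∞)} := by
    intro n
    have h1 := (hY.measurable_nextHit_pathEvents (hY.isClosed_of_finite hK)).mono
      (sup_le_sup le_rfl (MeasurableSpace.comap_mono pathEvents_le)) le_rfl
    exact measurableSet_le (h1.comp (measurable_const.prodMk measurable_id)) measurable_const
  have hanti : Antitone fun n : ℕ =>
      {ω | nextHit Y K 0 ω ≤ ((1 / (n + 1) : ℝ≥0) : ℝ≥0∞)} := by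
    intro n m hnm ω hω
    refine le_trans (show nextHit Y K 0 ω ≤ _ from hω) (ENNReal.coe_le_coe.2 ?_)
    gcongr
  have h2 := tendsto_measure_iInter_atTop (μ := P a) (fun n => (hm n).nullMeasurableSet) hanti
    ⟨0, measure_ne_top _ _⟩
  have h3 : P a (⋂ n : ℕ, {ω | nextHit Y K 0 ω ≤ ((1 / (n + 1) : ℝ≥0) : ℝ≥0∞)}) = 0 := by
    refine measure_mono_null (t := {ω | 0 < nextHit Y K 0 ω}ᶜ) (fun ω hω hpos => ?_)
      (hY.ae_nextHit_pos hK hirr ha)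
    rw [mem_iInter] at hω
    obtain ⟨r, hr, hrlt⟩ := ENNReal.lt_iff_exists_nnreal_btwn.1 (show 0 < nextHit Y K 0 ω from hpos)
    obtain ⟨n, hn⟩ := exists_nat_one_div_lt (ENNReal.coe_pos.1 hr)
    exact absurd (hrlt.trans_le (show nextHit Y K 0 ω ≤ _ from hω n))
      (not_lt.2 (ENNReal.coe_le_coe.2 hn.le))
  rwa [h3] at h2

/-- After a stopping time at which the process is in a finite set of irregular points, it does not
return to this set immediately. -/
lemma ae_lt_nextHit (x : S) {τ : Ω → WithTop ℝ≥0} (hτ : IsStoppingTime F τ)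
    (hτK : ∀ᵐ ω ∂(P x), ∀ s : ℝ≥0, τ ω = s → Y s ω ∈ K) :
    ∀ᵐ ω ∂(P x), ∀ s : ℝ≥0, τ ω = s → (s : ℝ≥0∞) < nextHit Y K s ω := by
  have key : ∀ a ∈ K, ∀ᵐ ω ∂(P x), ∀ s : ℝ≥0, τ ω = s → Y s ω = a →
      (s : ℝ≥0∞) < nextHit Y K s ω := by
    intro a ha
    have hE := hY.measurableSet_mem_of_isStoppingTime
      (hY.isClosed_of_finite (finite_singleton a)) hτ
    set E := {ω | ∃ s : ℝ≥0, τ ω = s ∧ Y s ω ∈ ({a} : Set S)} with hEdef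
    -- Immediate return is not itself an event with the required right-continuity, since that
    -- argument needs a positive delay. It is bounded by return within `1 / (n + 1)`, and `n → ∞`.
    have h1 : ∀ n : ℕ, P x (E ∩ {ω | ∃ s : ℝ≥0, τ ω = s ∧ nextHit Y K s ω ≤ s}) ≤
        P x E * P a {ω | nextHit Y K 0 ω ≤ ((1 / (n + 1) : ℝ≥0) : ℝ≥0∞)} := by
      intro n
      rw [← hY.measure_inter_nextHit_le hK (by positivity) hτ hE fun ω hω => hω]
      refine measure_mono (inter_subset_inter_right _ ?_)
      rintro ω ⟨s, hs, hle⟩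
      exact ⟨s, hs, hle.trans le_self_add⟩
    have := hY.isProbabilityMeasure x
    have h2 := ENNReal.Tendsto.const_mul (hY.tendsto_measure_nextHit_le hK hirr ha)
      (Or.inr (measure_ne_top (P x) E))
    rw [mul_zero] at h2
    have h3 := le_antisymm (ge_of_tendsto' h2 h1) zero_le
    refine measure_mono_null (fun ω hω => ?_) h3
    rw [mem_compl_iff, mem_ofPred_eq] at hω
    push Not at hω
    obtain ⟨s, hs, hsa, hle⟩ := hω
    exact ⟨⟨s, hs, hsa⟩, s, hs, hle⟩
  filter_upwards [hτK, (ae_ball_iff hK.countable).2 key] with ω h1 h2 s hs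
  exact h2 _ (h1 s hs) s hs rfl

lemma exists_measure_nextHit_le_half :
    ∃ c : ℝ≥0, 0 < c ∧ ∀ a ∈ K, P a {ω | nextHit Y K 0 ω ≤ c} ≤ 2⁻¹ := by
  have h1 : ∀ᶠ n : ℕ in atTop, ∀ a ∈ K,
      P a {ω | nextHit Y K 0 ω ≤ ((1 / (n + 1) : ℝ≥0) : ℝ≥0∞)} ≤ 2⁻¹ :=
    (eventually_all_finite hK).2 fun a ha =>
      (hY.tendsto_measure_nextHit_le hK hirr ha).eventually (ge_mem_nhds (by simp))
  obtain ⟨n, hn⟩ := h1.exists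
  exact ⟨1 / (n + 1), by positivity, hn⟩

/-- Successive hitting times of a finite set of irregular points do not accumulate. -/
lemma ae_exists_le_of_succ_eq_hitAfter (x : S) {τ : ℕ → Ω → WithTop ℝ≥0}
    (hτ : ∀ j, IsStoppingTime F (τ j)) (hsucc : ∀ j ω, τ (j + 1) ω = hitAfter Y K (τ j ω) ω)
    (hτK : ∀ᵐ ω ∂(P x), ∀ (j : ℕ) (s : ℝ≥0), τ j ω = s → Y s ω ∈ K) :
    ∀ᵐ ω ∂(P x), ∀ M : ℕ, ∃ j, ((M : ℝ≥0) : WithTop ℝ≥0) ≤ τ j ω := by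
  have hprob := hY.isProbabilityMeasure
  obtain ⟨c, hc, hc2⟩ := hY.exists_measure_nextHit_le_half hK hirr
  have hmono : ∀ ω, Monotone fun j => τ j ω := fun ω =>
    monotone_nat_of_le_succ fun j => (hsucc j ω).symm ▸ le_hitAfter _ _
  -- This says `τ (k + 1) ≤ τ k + c` when `τ k` is finite, written with countably many thresholds so
  -- that it is visibly determined at time `τ (k + 1)`.
  let gap : ℕ → Set Ω := fun k => {ω | ∀ n, τ k ω < TopologicalSpace.denseSeq ℝ≥0 n →
    τ (k + 1) ω ≤ (TopologicalSpace.denseSeq ℝ≥0 n + c : ℝ≥0)}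
  -- Starting at index `m`, `n` short gaps in a row, with the last time still finite.
  let D : ℕ → ℕ → Set Ω := fun m n => {ω | τ (m + n) ω = ⊤}ᶜ ∩ ⋂ i, ⋂ (_ : i < n), gap (m + i)
  have hgap : ∀ k j, k < j → MeasurableSet[(hτ j).measurableSpace] (gap k) := by
    intro k j hkj
    have : gap k = ⋂ n, ({ω | τ k ω < TopologicalSpace.denseSeq ℝ≥0 n}ᶜ ∪
        {ω | τ (k + 1) ω ≤ (TopologicalSpace.denseSeq ℝ≥0 n + c : ℝ≥0)}) := by
      ext ω
      simp only [gap, mem_ofPred_eq, mem_iInter, mem_union, mem_compl_iff, imp_iff_not_or]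
    rw [this]
    refine MeasurableSet.iInter fun n => MeasurableSet.union (MeasurableSet.compl ?_) ?_
    · exact IsStoppingTime.measurableSpace_mono _ _ (fun ω => hmono ω hkj.le) _
        ((hτ k).measurableSet_lt' _)
    · exact IsStoppingTime.measurableSpace_mono _ _ (fun ω => hmono ω hkj) _
        ((hτ (k + 1)).measurableSet_le' _)
  have hD : ∀ m n, MeasurableSet[(hτ (m + n)).measurableSpace] (D m n) := fun m n =>
    MeasurableSet.inter (MeasurableSet.compl ((hτ (m + n)).measurable (measurableSet_singleton ⊤)))
      (MeasurableSet.iInter fun i => MeasurableSet.iInter fun hi => hgap _ _ (by omega))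
  -- Split according to the point of `K` occupied at `τ (m + n)`. By the strong Markov property the
  -- next gap is short with conditional probability at most `1/2`.
  have hstep : ∀ m n, P x (D m (n + 1)) ≤ 2⁻¹ * P x (D m n) := by
    intro m n
    let E : S → Set Ω := fun a => {ω | ∃ s : ℝ≥0, τ (m + n) ω = s ∧ Y s ω ∈ ({a} : Set S)}
    have hE : ∀ a, MeasurableSet[(hτ (m + n)).measurableSpace] (E a) := fun a =>
      hY.measurableSet_mem_of_isStoppingTime (hY.isClosed_of_finite (finite_singleton a)) _
    have hDE : ∀ a, MeasurableSet[(hτ (m + n)).measurableSpace] (D m n ∩ E a) := fun a =>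
      MeasurableSet.inter (hD m n) (hE a)
    have hsub : D m (n + 1) ≤ᵐ[P x] ⋃ a ∈ hK.toFinset, (D m n ∩ E a) ∩
        {ω | ∃ s : ℝ≥0, τ (m + n) ω = s ∧ nextHit Y K s ω ≤ s + c} := by
      filter_upwards [hτK] with ω hωK hω
      obtain ⟨hω1, hω2⟩ : ω ∈ D m (n + 1) := hω
      have hne : τ (m + n) ω ≠ ⊤ := fun h =>
        hω1 (top_le_iff.1 (h ▸ hmono ω (show m + n ≤ m + (n + 1) by omega)))
      obtain ⟨s, hs⟩ := WithTop.ne_top_iff_exists.1 hne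
      simp only [mem_iInter] at hω2
      refine mem_iUnion₂.2 ⟨Y s ω, hK.mem_toFinset.2 (hωK _ s hs.symm), ⟨⟨hne, ?_⟩, s, hs.symm, rfl⟩,
        s, hs.symm, ?_⟩
      · simp only [mem_iInter]
        exact fun i hi => hω2 i (by omega)
      · have hg : ω ∈ gap (m + n) := hω2 n (by omega)
        refine le_of_forall_gt fun u hu => ?_
        obtain ⟨v, hv, hvu⟩ := ENNReal.lt_iff_exists_nnreal_btwn.1 hu
        rw [← ENNReal.coe_add, ENNReal.coe_lt_coe, ← lt_tsub_iff_right] at hv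
        obtain ⟨k, hk1, hk2⟩ := exists_denseSeq_btwn hv
        have h2 := hg k (by rw [← hs]; exact WithTop.coe_lt_coe.2 hk1)
        rw [hsucc, ← hs, hitAfter_coe] at h2
        exact lt_of_le_of_lt h2 (lt_trans (ENNReal.coe_lt_coe.2 (lt_tsub_iff_right.1 hk2)) hvu)
    calc P x (D m (n + 1)) ≤ ∑ a ∈ hK.toFinset, P x ((D m n ∩ E a) ∩
          {ω | ∃ s : ℝ≥0, τ (m + n) ω = s ∧ nextHit Y K s ω ≤ s + c}) :=
          (measure_mono_ae hsub).trans (measure_biUnion_finset_le _ _)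
      _ = ∑ a ∈ hK.toFinset, P x (D m n ∩ E a) * P a {ω | nextHit Y K 0 ω ≤ c} :=
          Finset.sum_congr rfl fun a _ =>
            hY.measure_inter_nextHit_le hK hc _ (hDE a) fun ω hω => hω.2
      _ ≤ ∑ a ∈ hK.toFinset, P x (D m n ∩ E a) * 2⁻¹ :=
          Finset.sum_le_sum fun a ha => by gcongr; exact hc2 a (hK.mem_toFinset.1 ha)
      _ = 2⁻¹ * P x (⋃ a ∈ hK.toFinset, D m n ∩ E a) := by
          rw [← Finset.sum_mul, mul_comm, measure_biUnion_finset]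
          · intro a _ b _ hab
            refine disjoint_left.2 fun ω h1 h2 => hab ?_
            obtain ⟨s, hs, hsa⟩ := h1.2
            obtain ⟨s', hs', hsb⟩ := h2.2
            rw [hs, WithTop.coe_inj] at hs'
            subst hs'
            exact hsa.symm.trans hsb
          · exact fun a _ => IsStoppingTime.measurableSpace_le _ _ (hDE a)
      _ ≤ 2⁻¹ * P x (D m n) := by
          gcongr
          exact iUnion₂_subset fun a _ => inter_subset_left
  have hpow : ∀ m n, P x (D m n) ≤ 2⁻¹ ^ n := by
    intro m n
    induction n with
    | zero => simpa using prob_le_one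
    | succ n ih =>
      rw [pow_succ']
      exact (hstep m n).trans (by gcongr)
  have hnull : ∀ m, ∀ᵐ ω ∂(P x), ∃ n, ω ∉ D m n := by
    intro m
    have h1 : Tendsto (fun n : ℕ => (2⁻¹ : ℝ≥0∞) ^ n) atTop (𝓝 0) :=
      ENNReal.tendsto_pow_atTop_nhds_zero_of_lt_one (by simp)
    have h2 : P x (⋂ n, D m n) = 0 := le_antisymm (ge_of_tendsto' h1 fun n =>
      (measure_mono (iInter_subset _ n)).trans (hpow m n)) zero_le
    refine measure_mono_null (fun ω hω => ?_) h2
    rw [mem_compl_iff, mem_ofPred_eq] at hω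
    push Not at hω
    exact mem_iInter.2 hω
  filter_upwards [ae_all_iff.2 hnull] with ω hω
  -- After every index there is an infinite time or a gap longer than `c`, so each multiple of `c`
  -- is eventually passed.
  have hprog : ∀ i : ℕ, ∃ j, ((i * c : ℝ≥0) : WithTop ℝ≥0) ≤ τ j ω := by
    intro i
    induction i with
    | zero => exact ⟨0, by simp⟩
    | succ i ih =>
      obtain ⟨m, hm⟩ := ih
      obtain ⟨n, hn⟩ := hω m
      by_cases htop : τ (m + n) ω = ⊤
      · exact ⟨m + n, by rw [htop]; exact le_top⟩
      · have : ¬ ω ∈ ⋂ i, ⋂ (_ : i < n), gap (m + i) := fun h => hn ⟨htop, h⟩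
        simp only [mem_iInter, not_forall] at this
        obtain ⟨l, hl, hgl⟩ := this
        have hgl' : ¬ ∀ n, τ (m + l) ω < TopologicalSpace.denseSeq ℝ≥0 n →
          τ (m + l + 1) ω ≤ (TopologicalSpace.denseSeq ℝ≥0 n + c : ℝ≥0) := hgl
        push Not at hgl'
        obtain ⟨k, hk1, hk2⟩ := hgl'
        refine ⟨m + l + 1, le_trans (WithTop.coe_le_coe.2 ?_) hk2.le⟩
        have hk3 := (hm.trans (hmono ω (show m ≤ m + l by omega))).trans_lt hk1
        rw [WithTop.coe_lt_coe] at hk3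
        rw [Nat.cast_add, Nat.cast_one, add_mul, one_mul]
        gcongr
  intro M
  obtain ⟨i, hi⟩ := exists_nat_ge ((M : ℝ≥0) / c)
  obtain ⟨j, hj⟩ := hprog i
  exact ⟨j, le_trans (WithTop.coe_le_coe.2 ((div_le_iff₀ hc).1 hi)) hj⟩

end IsRightProcess

end FiniteSets

/-! ### The sequence of labels -/

section Labels

variable {S Ω : Type*} {Y : ℝ≥0 → Ω → S} {L : ℕ+ → S}

lemma hitTime_le_succ (N : ℕ+) (j : ℕ) (ω : Ω) : hitTime Y L N j ω ≤ hitTime Y L N (j + 1) ω :=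
  le_hitAfter _ _

lemma monotone_hitTime (N : ℕ+) (ω : Ω) : Monotone fun j => hitTime Y L N j ω :=
  monotone_nat_of_le_succ fun j => hitTime_le_succ N j ω

lemma hitTime_succ_of_eq {N : ℕ+} {j : ℕ} {ω : Ω} {s : ℝ≥0} (h : hitTime Y L N j ω = s) :
    hitTime Y L N (j + 1) ω = nextHit Y (L '' Iic N) s ω :=
  (congrArg (fun r => hitAfter Y (L '' Iic N) r ω) h).trans (hitAfter_coe s ω)

/-- The label `a` of the point `y = L a`, and `0` if there is none. -/
noncomputable def stateLabel (L : ℕ+ → S) (y : S) : ℕ :=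
  open Classical in if h : ∃ a, y = L a then (h.choose : ℕ) else 0

lemma stateLabel_apply (hL : Function.Injective L) (a : ℕ+) : stateLabel L (L a) = a := by
  have h : ∃ b, L a = L b := ⟨a, rfl⟩
  rw [stateLabel, dif_pos h, hL h.choose_spec.symm]

/-- The label of the state of the path at time `t`, and `0` at time `∞`. -/
noncomputable def labelAt (Y : ℝ≥0 → Ω → S) (L : ℕ+ → S) (ω : Ω) (t : WithTop ℝ≥0) : ℕ :=
  WithTop.recTopCoe (C := fun _ => ℕ) 0 (fun s => stateLabel L (Y s ω)) t

@[simp] lemma labelAt_top (ω : Ω) : labelAt Y L ω ⊤ = 0 := rfl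

lemma labelAt_coe (ω : Ω) (s : ℝ≥0) : labelAt Y L ω s = stateLabel L (Y s ω) := rfl

/-- The event that the first visit of `{L 1, ..., L N}` strictly after time `r` is to the point
with label `b`; for `b = 0`, that there is no such visit. -/
def nextLabelEvent (Y : ℝ≥0 → Ω → S) (L : ℕ+ → S) (N : ℕ+) (b : ℕ) (r : ℝ≥0) (ω : Ω) : Prop :=
  (b = 0 ∧ nextHit Y (L '' Iic N) r ω = ⊤) ∨ ∃ a : ℕ+, (a : ℕ) = b ∧ a ≤ N ∧
    nextHit Y {L a} r ω = nextHit Y (L '' Iic N) r ω ∧ nextHit Y (L '' Iic N) r ω ≠ ⊤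

/-- Just after `s` no labelled point up to `N` is visited, so the next visits to the whole set and
to its single points are unchanged. This is the right-continuity that the strong Markov property
asks for. -/
lemma eventually_nextLabelEvent_iff {N : ℕ+} {b : ℕ} {s : ℝ≥0} {ω : Ω}
    (h : (s : ℝ≥0∞) < nextHit Y (L '' Iic N) s ω) :
    ∀ᶠ r in 𝓝[>] s, (nextLabelEvent Y L N b r ω ↔ nextLabelEvent Y L N b s ω) := by
  have h1 : ∀ᶠ r in 𝓝 s, ((r : ℝ≥0) : ℝ≥0∞) < nextHit Y (L '' Iic N) s ω :=
    (ENNReal.continuous_coe.tendsto s).eventually (gt_mem_nhds h)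
  filter_upwards [self_mem_nhdsWithin, mem_nhdsWithin_of_mem_nhds h1] with r hr hlt
  have hK : nextHit Y (L '' Iic N) r ω = nextHit Y (L '' Iic N) s ω :=
    nextHit_eq_of_lt (le_of_lt hr) hlt
  have ha : ∀ a ≤ N, nextHit Y {L a} r ω = nextHit Y {L a} s ω := fun a ha =>
    nextHit_eq_of_lt (le_of_lt hr)
      (hlt.trans_le (nextHit_anti (show ({L a} : Set S) ⊆ L '' Iic N from
        singleton_subset_iff.2 (mem_image_of_mem L ha)) s ω))
  simp only [nextLabelEvent, hK]
  refine or_congr Iff.rfl (exists_congr fun a =>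
    and_congr_right fun _ => and_congr_right fun haN => ?_)
  rw [ha a haN]

variable [TopologicalSpace S]

/-- The right-continuous paths for which the successive hitting times are strictly increasing
and unbounded. -/
def goodPaths (Y : ℝ≥0 → Ω → S) (L : ℕ+ → S) : Set Ω :=
  rightContPaths Y ∩ {ω | ∀ (N : ℕ+),
    (∀ j, hitTime Y L N j ω ≠ ⊤ → hitTime Y L N j ω < hitTime Y L N (j + 1) ω) ∧
    ∀ M : ℕ, ∃ j, ((M : ℝ≥0) : WithTop ℝ≥0) ≤ hitTime Y L N j ω}

lemma mem_of_hitTime_eq [T2Space S] {ω : Ω} (hω : ω ∈ rightContPaths Y) {N : ℕ+} {j : ℕ} {s : ℝ≥0}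
    (h : hitTime Y L N j ω = s) : Y s ω ∈ L '' Iic N := by
  have hcl : IsClosed (L '' Iic N) := ((finite_Iic N).image L).isClosed
  cases j with
  | zero => exact mem_of_sInf_eq hcl (w := fun t => Y t ω) hω (fun _ ht => ht) h
  | succ j =>
    have hle := hitTime_le_succ (Y := Y) (L := L) N j ω
    rw [h] at hle
    obtain ⟨r, hr⟩ := WithTop.ne_top_iff_exists.1 (ne_top_of_le_ne_top WithTop.coe_ne_top hle)
    rw [hitTime_succ_of_eq hr.symm] at h
    exact mem_of_nextHit_eq hcl hω h

section GoodPath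

variable {ω : Ω} (hω : ω ∈ goodPaths Y L) {N : ℕ+}
include hω

lemma hitTime_lt_of_lt {i j : ℕ} (hij : i < j) (hi : hitTime Y L N i ω ≠ ⊤) :
    hitTime Y L N i ω < hitTime Y L N j ω :=
  ((hω.2 N).1 i hi).trans_le (monotone_hitTime N ω hij)

/-- Every visit is one of the successive hitting times. -/
lemma exists_hitTime_eq {s : ℝ≥0} (hs : Y s ω ∈ L '' Iic N) : ∃ j, hitTime Y L N j ω = s := by
  classical
  have hex : ∃ j, (s : WithTop ℝ≥0) ≤ hitTime Y L N j ω := by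
    obtain ⟨M, hM⟩ := exists_nat_ge s
    obtain ⟨j, hj⟩ := (hω.2 N).2 M
    exact ⟨j, (WithTop.coe_le_coe.2 hM).trans hj⟩
  -- For the least `j` with `s ≤ τ j`, the preceding time is before `s`, so `s` competes in the
  -- infimum defining `τ j`. Such a `j` exists because the hitting times are unbounded.
  refine ⟨Nat.find hex, le_antisymm ?_ (Nat.find_spec hex)⟩
  cases hn : Nat.find hex with
  | zero => exact entryTime_le hs
  | succ j => exact hitAfter_le (not_le.1 (Nat.find_min hex (hn ▸ Nat.lt_succ_self j))) hs

variable [T2Space S] (hL : Function.Injective L)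
include hL

lemma labelAt_hitTime_of_eq {j : ℕ} {s : ℝ≥0} (h : hitTime Y L N j ω = s) :
    ∃ a : ℕ+, a ≤ N ∧ Y s ω = L a ∧ labelAt Y L ω (hitTime Y L N j ω) = a := by
  obtain ⟨a, ha, hs⟩ := mem_of_hitTime_eq hω.1 h
  exact ⟨a, ha, hs.symm, by rw [h, labelAt_coe, ← hs, stateLabel_apply hL]⟩

lemma labelAt_hitTime_eq_zero_iff {j : ℕ} :
    labelAt Y L ω (hitTime Y L N j ω) = 0 ↔ hitTime Y L N j ω = ⊤ := by
  refine ⟨fun h => ?_, fun h => by rw [h]; rfl⟩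
  by_contra hne
  obtain ⟨s, hs⟩ := WithTop.ne_top_iff_exists.1 hne
  obtain ⟨a, -, -, ha⟩ := labelAt_hitTime_of_eq hω hL hs.symm
  exact a.ne_zero (ha.symm.trans h)

lemma labelAt_hitTime_eq_iff {j : ℕ} {a : ℕ+} :
    labelAt Y L ω (hitTime Y L N j ω) = a ↔ ∃ s : ℝ≥0, hitTime Y L N j ω = s ∧ Y s ω = L a := by
  constructor
  · intro h
    have hne : hitTime Y L N j ω ≠ ⊤ := fun h' =>
      a.ne_zero (h.symm.trans ((labelAt_hitTime_eq_zero_iff hω hL).2 h'))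
    obtain ⟨s, hs⟩ := WithTop.ne_top_iff_exists.1 hne
    obtain ⟨b, -, hb, hlb⟩ := labelAt_hitTime_of_eq hω hL hs.symm
    rw [h, PNat.coe_inj] at hlb
    exact ⟨s, hs.symm, hlb ▸ hb⟩
  · rintro ⟨s, hs, hsa⟩
    rw [hs, labelAt_coe, hsa, stateLabel_apply hL]

lemma labelAt_hitTime_mem_paths :
    (fun j => labelAt Y L ω (hitTime Y L N j ω)) ∈ paths N := by
  refine ⟨fun j => ?_, fun i hi j hij => ?_⟩
  · by_cases h : hitTime Y L N j ω = ⊤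
    · simp [h]
    · obtain ⟨s, hs⟩ := WithTop.ne_top_iff_exists.1 h
      obtain ⟨a, haN, -, ha⟩ := labelAt_hitTime_of_eq hω hL hs.symm
      exact ha.trans_le haN
  · refine (labelAt_hitTime_eq_zero_iff hω hL).2 (top_le_iff.1 ?_)
    exact ((labelAt_hitTime_eq_zero_iff hω hL).1 hi).symm.le.trans (monotone_hitTime N ω hij)

lemma labelAt_hitTime_le_iff {M : ℕ+} {j : ℕ} : labelAt Y L ω (hitTime Y L M j ω) ≤ N ↔
    ∀ s : ℝ≥0, hitTime Y L M j ω = s → Y s ω ∈ L '' Iic N := by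
  constructor
  · intro h s hs
    obtain ⟨a, -, ha, hla⟩ := labelAt_hitTime_of_eq hω hL hs
    rw [hla] at h
    exact ⟨a, h, ha.symm⟩
  · intro h
    by_cases htop : hitTime Y L M j ω = ⊤
    · simp [htop]
    · obtain ⟨s, hs⟩ := WithTop.ne_top_iff_exists.1 htop
      obtain ⟨a, ha, has⟩ := h s hs.symm
      rw [← hs, labelAt_coe, ← has, stateLabel_apply hL]
      exact ha

end GoodPath

/-! ### Consistency of the label sequences under the projections -/

lemma sInf_image_natCast_eq {T : Set ℕ} {i : ℕ} (hi : i ∈ T) (hmin : ∀ k ∈ T, i ≤ k) :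
    sInf ((fun i : ℕ => (i : ℕ∞)) '' T) = i :=
  le_antisymm (sInf_le ⟨i, hi, rfl⟩)
    (le_sInf (by rintro _ ⟨k, hk, rfl⟩; exact Nat.cast_le.2 (hmin k hk)))

lemma sInf_image_natCast_eq_top_or (T : Set ℕ) :
    sInf ((fun i : ℕ => (i : ℕ∞)) '' T) = ⊤ ∨
      ∃ i ∈ T, sInf ((fun i : ℕ => (i : ℕ∞)) '' T) = i := by
  classical
  by_cases h : ∃ i, i ∈ T
  · exact Or.inr ⟨Nat.find h, Nat.find_spec h,
      sInf_image_natCast_eq (Nat.find_spec h) fun k hk => Nat.find_min' h hk⟩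
  · left
    rw [eq_empty_of_forall_notMem fun i hi => h ⟨i, hi⟩, image_empty, sInf_empty]

/-- The `j`-th hitting time of `{L 1, ..., L N}` is the hitting time of `{L 1, ..., L M}`
indexed by the `j`-th label at most `N`. -/
lemma visitIndex_labelAt [T2Space S] {ω : Ω} (hω : ω ∈ goodPaths Y L) (hL : Function.Injective L)
    {N M : ℕ+} (hNM : N ≤ M) (j : ℕ) :
    (∀ s : ℝ≥0, hitTime Y L N j ω = s → ∃ i : ℕ,
      visitIndex N (fun i => labelAt Y L ω (hitTime Y L M i ω)) j = i ∧ hitTime Y L M i ω = s) ∧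
    (hitTime Y L N j ω = ⊤ →
      visitIndex N (fun i => labelAt Y L ω (hitTime Y L M i ω)) j = ⊤ ∨ ∃ i : ℕ,
      visitIndex N (fun i => labelAt Y L ω (hitTime Y L M i ω)) j = i ∧
        hitTime Y L M i ω = ⊤) := by
  have hsub : L '' Iic N ⊆ L '' Iic M := image_mono (Iic_subset_Iic.2 hNM)
  have hle : ∀ i, labelAt Y L ω (hitTime Y L M i ω) ≤ N → hitTime Y L M i ω ≠ ⊤ →
      ∃ s : ℝ≥0, hitTime Y L M i ω = s ∧ Y s ω ∈ L '' Iic N := by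
    intro i hi hne
    obtain ⟨s, hs⟩ := WithTop.ne_top_iff_exists.1 hne
    exact ⟨s, hs.symm, (labelAt_hitTime_le_iff hω hL).1 hi s hs.symm⟩
  have hlabel : ∀ (i : ℕ) (s : ℝ≥0), hitTime Y L M i ω = s → Y s ω ∈ L '' Iic N →
      labelAt Y L ω (hitTime Y L M i ω) ≤ N := by
    intro i s hs hsN
    refine (labelAt_hitTime_le_iff hω hL).2 fun s' hs' => ?_
    rw [hs, WithTop.coe_inj] at hs'
    rwa [← hs']
  have hne_of_lt : ∀ {i k : ℕ}, i < k → hitTime Y L M k ω ≠ ⊤ →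
      hitTime Y L M i ω < hitTime Y L M k ω := fun {i k} hik hk =>
    hitTime_lt_of_lt hω hik (ne_top_of_le_ne_top hk (monotone_hitTime M ω hik.le))
  induction j with
  | zero =>
    refine ⟨fun s hs => ?_, fun htop => ?_⟩
    · have hsN := mem_of_hitTime_eq hω.1 hs
      obtain ⟨i, hi⟩ := exists_hitTime_eq hω (hsub hsN)
      refine ⟨i, sInf_image_natCast_eq (hlabel i s hi hsN) fun k hk => ?_, hi⟩
      by_contra! hki
      have hlt := hne_of_lt hki (by rw [hi]; exact WithTop.coe_ne_top)
      obtain ⟨s', hs', hsN'⟩ := hle k hk hlt.ne_top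
      have h1 : hitTime Y L N 0 ω ≤ s' := entryTime_le hsN'
      rw [hs, ← hi, ← hs'] at h1
      exact absurd hlt (not_lt.2 h1)
    -- The padding label `0` is also at most `N`. So when the points up to `N` are never hit, the
    -- visit index is either infinite or points at a padding zero, that is, at an infinite hitting
    -- time.
    · refine (sInf_image_natCast_eq_top_or _).imp id ?_
      rintro ⟨i, hi, h⟩
      refine ⟨i, h, ?_⟩
      by_contra hne
      obtain ⟨s', hs', hsN'⟩ := hle i hi hne
      have h1 : hitTime Y L N 0 ω ≤ s' := entryTime_le hsN'
      rw [htop, top_le_iff] at h1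
      exact WithTop.coe_ne_top h1
  | succ j ih =>
    by_cases hjtop : hitTime Y L N j ω = ⊤
    · have htop : hitTime Y L N (j + 1) ω = ⊤ :=
        top_le_iff.1 (hjtop.symm.le.trans (hitTime_le_succ N j ω))
      refine ⟨fun s hs => absurd (htop.symm.trans hs) WithTop.coe_ne_top.symm, fun _ => ?_⟩
      refine (sInf_image_natCast_eq_top_or _).imp id ?_
      rintro ⟨i, hi, h⟩
      refine ⟨i, h, ?_⟩
      rcases ih.2 hjtop with hv | ⟨i₀, hv, hi₀⟩
      · exact absurd (hv ▸ hi.1) not_top_lt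
      · have hlt : i₀ < i := Nat.cast_lt.1 (hv ▸ hi.1)
        exact top_le_iff.1 (hi₀.symm.le.trans (monotone_hitTime M ω hlt.le))
    · obtain ⟨r, hr⟩ := WithTop.ne_top_iff_exists.1 hjtop
      obtain ⟨i₀, hv, hi₀⟩ := ih.1 r hr.symm
      -- A later entry with label at most `N` is padding or a visit to the smaller set after its
      -- `j`-th hitting time, so it cannot come before the next one.
      have hnext : ∀ k : ℕ, i₀ < k → labelAt Y L ω (hitTime Y L M k ω) ≤ N →
          hitTime Y L N (j + 1) ω ≤ hitTime Y L M k ω := by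
        intro k hk hkN
        by_cases hne : hitTime Y L M k ω = ⊤
        · rw [hne]; exact le_top
        · obtain ⟨s', hs', hsN'⟩ := hle k hkN hne
          have hlt := hne_of_lt hk hne
          rw [hi₀, hr, hs'] at hlt
          rw [hs']
          exact hitAfter_le hlt hsN'
      refine ⟨fun s hs => ?_, fun htop => ?_⟩
      · have hsN := mem_of_hitTime_eq hω.1 hs
        obtain ⟨i, hi⟩ := exists_hitTime_eq hω (hsub hsN)
        have hlt : hitTime Y L N j ω < hitTime Y L N (j + 1) ω := (hω.2 N).1 j hjtop
        rw [← hr, ← hi₀, hs, ← hi] at hlt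
        have hii : i₀ < i := (monotone_hitTime M ω).reflect_lt hlt
        refine ⟨i, sInf_image_natCast_eq
          ⟨by rw [hv]; exact Nat.cast_lt.2 hii, hlabel i s hi hsN⟩ fun k hk => ?_, hi⟩
        by_contra! hki
        have hlt' := hne_of_lt hki (by rw [hi]; exact WithTop.coe_ne_top)
        have hk1 : i₀ < k := Nat.cast_lt.1 (hv ▸ hk.1)
        have := hnext k hk1 hk.2
        rw [hs, ← hi] at this
        exact absurd hlt' (not_lt.2 this)
      · refine (sInf_image_natCast_eq_top_or _).imp id ?_
        rintro ⟨i, hi, h⟩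
        have hi1 : i₀ < i := Nat.cast_lt.1 (hv ▸ hi.1)
        exact ⟨i, h, top_le_iff.1 (htop.symm.le.trans (hnext i hi1 hi.2))⟩

lemma proj_labelAt [T2Space S] {ω : Ω} (hω : ω ∈ goodPaths Y L) (hL : Function.Injective L)
    {N M : ℕ+} (hNM : N ≤ M) :
    proj N (fun i => labelAt Y L ω (hitTime Y L M i ω)) =
      fun j => labelAt Y L ω (hitTime Y L N j ω) := by
  ext j
  obtain ⟨h1, h2⟩ := visitIndex_labelAt hω hL hNM j
  by_cases htop : hitTime Y L N j ω = ⊤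
  · rw [htop, labelAt_top]
    rcases h2 htop with h | ⟨i, hv, hi⟩
    · simp only [proj, h, if_pos]
    · simp only [proj, hv, ENat.natCast_ne_top, if_false, ENat.toNat_natCast, hi, labelAt_top]
  · obtain ⟨s, hs⟩ := WithTop.ne_top_iff_exists.1 htop
    obtain ⟨i, hv, hi⟩ := h1 s hs.symm
    simp only [proj, hv, ENat.natCast_ne_top, if_false, ENat.toNat_natCast, hi, ← hs]

lemma zero_mem_virtualPath : (∀ N : ℕ+, (fun _ => 0 : ℕ → ℕ) ∈ paths N) ∧
    ∀ N : ℕ+, proj N (fun _ => 0) = fun _ => 0 :=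
  ⟨fun N => ⟨fun _ => Nat.zero_le _, fun _ _ _ _ => rfl⟩, fun N => by ext j; simp [proj]⟩

open Classical in
/-- The virtual path formed by the labels at the successive hitting times. -/
noncomputable def virtualPath [T2Space S] (Y : ℝ≥0 → Ω → S) (hL : Function.Injective L) (ω : Ω) :
    VirtualPath :=
  ⟨fun N j => if ω ∈ goodPaths Y L then labelAt Y L ω (hitTime Y L N j ω) else 0, by
    by_cases hω : ω ∈ goodPaths Y L
    · simp only [if_pos hω]
      exact ⟨fun _ => labelAt_hitTime_mem_paths hω hL,
        fun N => proj_labelAt hω hL (PNat.lt_add_right N 1).le⟩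
    · simp only [if_neg hω]
      exact zero_mem_virtualPath⟩

lemma virtualPath_of_mem [T2Space S] (hL : Function.Injective L) {ω : Ω} (hω : ω ∈ goodPaths Y L)
    (N : ℕ+) (j : ℕ) : (virtualPath Y hL ω).1 N j = labelAt Y L ω (hitTime Y L N j ω) :=
  if_pos hω

lemma virtualPath_of_notMem [T2Space S] (hL : Function.Injective L) {ω : Ω}
    (hω : ω ∉ goodPaths Y L) (N : ℕ+) (j : ℕ) : (virtualPath Y hL ω).1 N j = 0 :=
  if_neg hω

lemma virtualPath_eq_iff [T2Space S] (hL : Function.Injective L) {ω : Ω} {N : ℕ+} {j : ℕ} {a : ℕ+} :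
    (virtualPath Y hL ω).1 N j = a ↔
      ω ∈ goodPaths Y L ∧ ∃ s : ℝ≥0, hitTime Y L N j ω = s ∧ Y s ω = L a := by
  by_cases hω : ω ∈ goodPaths Y L
  · rw [virtualPath_of_mem hL hω, labelAt_hitTime_eq_iff hω hL, and_iff_right hω]
  · rw [virtualPath_of_notMem hL hω]
    exact iff_of_false a.ne_zero.symm fun h => hω h.1

/-- The next label is expressed through the path after the current hitting time, in the form to
which the strong Markov property applies. -/
lemma virtualPath_succ_eq_iff [T2Space S] (hL : Function.Injective L) {ω : Ω}
    (hω : ω ∈ goodPaths Y L) {N : ℕ+} {j b : ℕ} {s : ℝ≥0} (hs : hitTime Y L N j ω = s) :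
    (virtualPath Y hL ω).1 N (j + 1) = b ↔ nextLabelEvent Y L N b s ω := by
  have hnext := hitTime_succ_of_eq hs
  rw [virtualPath_of_mem hL hω]
  by_cases htop : hitTime Y L N (j + 1) ω = ⊤
  · have htop' : nextHit Y (L '' Iic N) s ω = ⊤ := hnext.symm.trans htop
    simp [htop, nextLabelEvent, htop', eq_comm]
  · obtain ⟨t, ht⟩ := WithTop.ne_top_iff_exists.1 htop
    obtain ⟨a, haN, hta, hla⟩ := labelAt_hitTime_of_eq hω hL ht.symm
    have hnt : nextHit Y (L '' Iic N) s ω = t := hnext.symm.trans ht.symm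
    have hst : s < t := by
      have := (hω.2 N).1 j (by rw [hs]; exact WithTop.coe_ne_top)
      rw [hs, ← ht] at this
      exact WithTop.coe_lt_coe.1 this
    have hnt' : nextHit Y {L a} s ω = t :=
      le_antisymm (nextHit_le hst hta)
        (hnt ▸ nextHit_anti (show ({L a} : Set S) ⊆ L '' Iic N from
          singleton_subset_iff.2 (mem_image_of_mem L haN)) s ω)
    rw [hla]
    constructor
    · rintro rfl
      exact Or.inr ⟨a, rfl, haN, hnt'.trans hnt.symm, by rw [hnt]; exact ENNReal.coe_ne_top⟩
    · rintro (⟨-, h⟩ | ⟨a', rfl, -, h, -⟩)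
      · exact absurd (hnt.symm.trans h) ENNReal.coe_ne_top
      · have := mem_of_nextHit_eq isClosed_singleton hω.1 (h.trans hnt)
        rw [hL (hta.symm.trans this)]

end Labels

/-! ### The virtual Markov chain of labels -/

section LabelChain

variable {S Ω : Type*} [TopologicalSpace S] [MeasurableSpace S] [BorelSpace S]
  {mΩ : MeasurableSpace Ω} {P : S → Measure Ω}
  {F : Filtration ℝ≥0 mΩ} {Y : ℝ≥0 → Ω → S} {θ : ℝ≥0 → Ω → Ω} {L : ℕ+ → S}

namespace IsRightProcess

variable (hY : IsRightProcess F Y θ P)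
include hY

lemma isStoppingTime_hitTime (N : ℕ+) (j : ℕ) : IsStoppingTime F (hitTime Y L N j) := by
  have hcl : IsClosed (L '' Iic N) := hY.isClosed_of_finite ((finite_Iic N).image L)
  induction j with
  | zero => exact hY.isStoppingTime_entryTime hcl
  | succ j ih => exact hY.isStoppingTime_hitAfter hcl ih

lemma measurableSet_goodPaths : MeasurableSet (goodPaths Y L) := by
  have hm : ∀ N j, Measurable (hitTime Y L N j) := fun N j =>
    (hY.isStoppingTime_hitTime N j).measurable'
  refine hY.measurableSet_rightCont.inter ?_
  simp only [ofPred_forall, ofPred_and]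
  refine MeasurableSet.iInter fun N => MeasurableSet.inter ?_ ?_
  · refine MeasurableSet.iInter fun j => ?_
    simp only [imp_iff_not_or, ofPred_or]
    refine MeasurableSet.union ?_ (measurableSet_lt (hm N j) (hm N (j + 1)))
    simp only [not_not]
    exact hm N j (measurableSet_singleton ⊤)
  · refine MeasurableSet.iInter fun M => ?_
    simp only [ofPred_exists]
    exact MeasurableSet.iUnion fun j => measurableSet_le measurable_const (hm N j)

lemma measurableSet_hitTime_eq (N : ℕ+) (j : ℕ) (y : S) :
    MeasurableSet[(hY.isStoppingTime_hitTime (L := L) N j).measurableSpace]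
      {ω | ∃ s : ℝ≥0, hitTime Y L N j ω = s ∧ Y s ω = y} :=
  hY.measurableSet_mem_of_isStoppingTime (hY.isClosed_of_finite (finite_singleton y))
    (hY.isStoppingTime_hitTime N j)

lemma isPathEvent_nextLabelEvent (N : ℕ+) (b : ℕ) :
    IsPathEvent P Y θ (nextLabelEvent Y L N b) where
  measurableSet := by
    let _ : MeasurableSpace Ω := pathEvents P Y
    have hK := hY.measurable_nextHit_pathEvents
      (hY.isClosed_of_finite ((finite_Iic N).image L))
    have ha : ∀ a : ℕ+, _ := fun a =>
      hY.measurable_nextHit_pathEvents (hY.isClosed_of_finite (finite_singleton (L a)))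
    have htop := hK (measurableSet_singleton ⊤)
    simp only [nextLabelEvent, ofPred_or, ofPred_and, ofPred_exists]
    refine MeasurableSet.union ((MeasurableSet.const _).inter htop)
      (MeasurableSet.iUnion fun a => (MeasurableSet.const _).inter
        ((MeasurableSet.const _).inter (MeasurableSet.inter ?_ htop.compl)))
    exact measurableSet_eq_fun (ha a) hK
  shift r s ω := by
    simp only [nextLabelEvent, hY.nextHit_shift, ENNReal.add_eq_top, ENNReal.coe_ne_top, false_or,
      ENNReal.add_right_inj ENNReal.coe_ne_top, ne_eq]

lemma measurable_virtualPath [T2Space S] (hL : Function.Injective L) :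
    Measurable (virtualPath Y hL) := by
  refine Measurable.subtype_mk (measurable_pi_lambda _ fun N => measurable_pi_lambda _ fun j =>
    measurable_to_countable' fun b => ?_)
  have hpos : ∀ a : ℕ+, MeasurableSet {ω | (virtualPath Y hL ω).1 N j = a} := by
    intro a
    simp only [virtualPath_eq_iff]
    exact hY.measurableSet_goodPaths.inter
      (IsStoppingTime.measurableSpace_le _ _ (hY.measurableSet_hitTime_eq N j (L a)))
  rcases Nat.eq_zero_or_pos b with rfl | hb
  · convert (MeasurableSet.iUnion hpos).compl using 1
    ext ω
    simp only [mem_compl_iff, mem_iUnion, not_exists, mem_ofPred_eq]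
    constructor
    · intro h a ha
      exact a.ne_zero (ha.symm.trans h)
    · intro h
      by_contra hne
      exact h ⟨_, Nat.pos_of_ne_zero hne⟩ rfl
  · exact hpos ⟨b, hb⟩

variable (hirr : ∀ N, IsIrregularForItself Y P (L N))
include hirr

lemma ae_mem_goodPaths (x : S) : ∀ᵐ ω ∂(P x), ω ∈ goodPaths Y L := by
  have := hY.t2Space
  have hfin : ∀ N, (L '' Iic N).Finite := fun N => (finite_Iic N).image L
  have hirr' : ∀ N, ∀ a ∈ L '' Iic N, IsIrregularForItself Y P a := by
    rintro N _ ⟨a, -, rfl⟩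
    exact hirr a
  have hR : ∀ᵐ ω ∂(P x), ω ∈ rightContPaths Y := hY.measure_compl_rightContPaths x
  have hmem : ∀ N, ∀ᵐ ω ∂(P x), ∀ (j : ℕ) (s : ℝ≥0), hitTime Y L N j ω = s →
      Y s ω ∈ L '' Iic N := fun N => hR.mono fun ω hω j s hs => mem_of_hitTime_eq hω hs
  have h1 : ∀ N j, ∀ᵐ ω ∂(P x), ∀ s : ℝ≥0, hitTime Y L N j ω = s →
      (s : ℝ≥0∞) < nextHit Y (L '' Iic N) s ω := fun N j =>
    hY.ae_lt_nextHit (hfin N) (hirr' N) x (hY.isStoppingTime_hitTime N j)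
      ((hmem N).mono fun ω hω => hω j)
  have h2 : ∀ N, ∀ᵐ ω ∂(P x), ∀ M : ℕ, ∃ j, ((M : ℝ≥0) : WithTop ℝ≥0) ≤ hitTime Y L N j ω :=
    fun N => hY.ae_exists_le_of_succ_eq_hitAfter (hfin N) (hirr' N) x
      (hY.isStoppingTime_hitTime N) (fun _ _ => rfl) (hmem N)
  filter_upwards [hR, ae_all_iff.2 fun N => ae_all_iff.2 (h1 N), ae_all_iff.2 h2]
    with ω hω hω1 hω2
  refine ⟨hω, fun N => ⟨fun j hj => ?_, hω2 N⟩⟩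
  obtain ⟨s, hs⟩ := WithTop.ne_top_iff_exists.1 hj
  exact hs.symm.trans_lt ((hω1 N j s hs.symm).trans_eq (hitTime_succ_of_eq hs.symm).symm)

/-- The Markov property of the sequence of labels, at a step where the label is not `0`. -/
lemma measure_virtualPath_succ [T2Space S] (hL : Function.Injective L) (x : S) (N : ℕ+) (l : ℕ)
    (a : ℕ → ℕ) {c : ℕ+} (hcN : c ≤ N) (hc : a l = c) :
    P x {ω | ∀ i, i ≤ l + 1 → (virtualPath Y hL ω).1 N i = a i} =
      P x {ω | ∀ i, i ≤ l → (virtualPath Y hL ω).1 N i = a i} *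
        P (L c) {ω | (virtualPath Y hL ω).1 N 1 = a (l + 1)} := by
  -- A prescribed zero up to time `l` contradicts absorption, since `a l = c` is positive; both
  -- sides then vanish. Otherwise all prescribed labels are genuine.
  by_cases hzero : ∃ i ≤ l, a i = 0
  · obtain ⟨i, hil, hi⟩ := hzero
    have hempty : {ω | ∀ i, i ≤ l → (virtualPath Y hL ω).1 N i = a i} = ∅ := by
      refine eq_empty_of_forall_notMem fun ω hω => c.ne_zero ?_
      rw [← hc, ← hω l le_rfl]
      exact ((virtualPath Y hL ω).2.1 N).2 i ((hω i hil).trans hi) l hil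
    rw [hempty, measure_empty, zero_mul]
    exact measure_mono_null (t := {ω | ∀ i, i ≤ l → (virtualPath Y hL ω).1 N i = a i})
      (fun ω hω i hi => hω i (hi.trans l.le_succ)) ((congrArg (P x) hempty).trans measure_empty)
  have hpos : ∀ i ≤ l, ((a i).toPNat' : ℕ) = a i := fun i hi => by
    rw [Nat.toPNat'_coe, if_pos (Nat.pos_of_ne_zero fun h => hzero ⟨i, hi, h⟩)]
  have hcl : (a l).toPNat' = c := PNat.coe_injective ((hpos l le_rfl).trans hc)
  have hτ := hY.isStoppingTime_hitTime (L := L) N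
  set E : Set Ω := ⋂ i, ⋂ (_ : i ≤ l),
    {ω | ∃ s : ℝ≥0, hitTime Y L N i ω = s ∧ Y s ω = L (a i).toPNat'} with hE
  have hEl : ∀ ω ∈ E, ∃ s : ℝ≥0, hitTime Y L N l ω = s ∧ Y s ω = L c := fun ω hω =>
    hcl ▸ mem_iInter₂.1 hω l le_rfl
  have hEmeas : MeasurableSet[(hτ l).measurableSpace] E :=
    MeasurableSet.iInter fun i => MeasurableSet.iInter fun hi =>
      IsStoppingTime.measurableSpace_mono _ _ (fun ω => monotone_hitTime N ω hi) _
        (hY.measurableSet_hitTime_eq N i _)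
  have hmemE : ∀ ω ∈ goodPaths Y L,
      ((∀ i, i ≤ l → (virtualPath Y hL ω).1 N i = a i) ↔ ω ∈ E) := by
    intro ω hω
    rw [hE, mem_iInter₂]
    refine forall₂_congr fun i hi => ?_
    rw [← hpos i hi, virtualPath_eq_iff, and_iff_right hω, hpos i hi]
    rfl
  have hirr' : ∀ y ∈ L '' Iic N, IsIrregularForItself Y P y := by
    rintro _ ⟨b, -, rfl⟩
    exact hirr b
  have hgood := fun y => hY.ae_mem_goodPaths hirr y
  -- Started at `L c`, the process is in the set at once, so hitting time number `0` is `0` and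
  -- label number `1` is the first one strictly after time `0`.
  have hstep : P (L c) {ω | (virtualPath Y hL ω).1 N 1 = a (l + 1)} =
      P (L c) {ω | nextLabelEvent Y L N (a (l + 1)) 0 ω} := by
    refine measure_congr ?_
    filter_upwards [hgood (L c), hY.ae_apply_zero_eq (L c)] with ω hω h0
    have hhit : hitTime Y L N 0 ω = (0 : ℝ≥0) :=
      le_antisymm (entryTime_le (by rw [h0]; exact mem_image_of_mem L hcN)) bot_le
    exact propext (virtualPath_succ_eq_iff hL hω hhit)
  have hE_ae : P x {ω | ∀ i, i ≤ l → (virtualPath Y hL ω).1 N i = a i} = P x E := by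
    refine measure_congr ?_
    filter_upwards [hgood x] with ω hω
    exact propext (hmemE ω hω)
  rw [hstep, hE_ae, ← hY.measure_inter_pathEvent (hY.isPathEvent_nextLabelEvent N (a (l + 1)))
    (hτ l) hEmeas hEl ?_ ?_]
  · refine measure_congr ?_
    filter_upwards [hgood x] with ω hω
    refine propext ?_
    have hsplit : (∀ i, i ≤ l + 1 → (virtualPath Y hL ω).1 N i = a i) ↔
        ω ∈ E ∧ (virtualPath Y hL ω).1 N (l + 1) = a (l + 1) := by
      simp only [Nat.le_succ_iff, or_imp, forall_and, forall_eq, hmemE ω hω]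
    refine hsplit.trans (and_congr_right fun hωE => ?_)
    obtain ⟨s, hs, -⟩ := hEl ω hωE
    rw [virtualPath_succ_eq_iff hL hω hs]
    constructor
    · exact fun h => ⟨s, hs, h⟩
    · rintro ⟨s', hs', h⟩
      rw [hs, WithTop.coe_inj] at hs'
      rwa [hs']
  · filter_upwards [hgood x] with ω hω s hs _
    refine eventually_nextLabelEvent_iff ?_
    have := (hω.2 N).1 l (hs.trans_ne WithTop.coe_ne_top)
    exact (hs.symm.trans_lt this).trans_eq (hitTime_succ_of_eq hs)
  · filter_upwards [hY.ae_nextHit_pos ((finite_Iic N).image L) hirr'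
      (mem_image_of_mem L hcN)] with ω hω
    exact eventually_nextLabelEvent_iff hω

theorem isVMC_virtualPath [T2Space S] (hL : Function.Injective L) (x : S) :
    IsVMC (P x) (virtualPath Y hL) where
  measurable := hY.measurable_virtualPath hL
  markov N := by
    have hprob := hY.isProbabilityMeasure
    have hX := hY.measurable_virtualPath hL
    have hmeas : ∀ i, Measurable fun ω => (virtualPath Y hL ω).1 N i := fun i =>
      (measurable_pi_apply i).comp ((measurable_pi_apply N).comp (measurable_subtype_coe.comp hX))
    have hle : ∀ i ω, (virtualPath Y hL ω).1 N i ≤ N := fun i ω =>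
      ((virtualPath Y hL ω).2.1 N).1 i
    refine ⟨hmeas, hle, ?_⟩
    -- Row `a > 0` is the law of label number `1` under `P (L a)`, and row `0` is the point mass at
    -- `0`. The matrix does not depend on the starting point `x`.
    let K : Fin (N + 1) → Fin (N + 1) → ℝ := fun a b =>
      if h : 0 < (a : ℕ) then (P (L ⟨a, h⟩)).real {ω | (virtualPath Y hL ω).1 N 1 = b}
      else if b = 0 then 1 else 0
    refine ⟨K, fun a b => ?_, fun a => ?_, by simp [K], fun l a => ?_⟩
    · simp only [K]
      split_ifs <;> first | exact measureReal_nonneg | norm_num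
    · by_cases h : 0 < (a : ℕ)
      · simp only [K, dif_pos h]
        let Z : Ω → Fin (N + 1) := fun ω =>
          ⟨(virtualPath Y hL ω).1 N 1, Nat.lt_succ_of_le (hle 1 ω)⟩
        have hZ : ∀ b : Fin (N + 1), {ω | (virtualPath Y hL ω).1 N 1 = (b : ℕ)} = Z ⁻¹' {b} :=
            fun b => by
          ext ω
          simp [Z, Fin.ext_iff]
        simp only [hZ]
        rw [sum_measureReal_preimage_singleton Finset.univ
          (fun b _ => by rw [← hZ b]; exact hmeas 1 (measurableSet_singleton (b : ℕ)))
          (fun b _ => measure_ne_top _ _)]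
        simp
      · simp only [K, dif_neg h]
        simp
    · by_cases h : 0 < (a l : ℕ)
      · have key := hY.measure_virtualPath_succ hirr hL x N l (fun i => (a i : ℕ))
          (c := ⟨a l, h⟩) (Nat.le_of_lt_succ (a l).2) rfl
        simp only [K, dif_pos h, Measure.real]
        rw [key, ENNReal.toReal_mul]
      · have hal : (a l : ℕ) = 0 := Nat.eq_zero_of_not_pos h
        simp only [K, dif_neg h]
        have hzero : ∀ ω, (∀ i, i ≤ l → (virtualPath Y hL ω).1 N i = a i) →
            (virtualPath Y hL ω).1 N (l + 1) = 0 := fun ω hω =>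
          ((virtualPath Y hL ω).2.1 N).2 l ((hω l le_rfl).trans hal) (l + 1) l.le_succ
        split_ifs with hb
        · rw [mul_one]
          congr 1
          ext ω
          refine ⟨fun hω i hi => hω i (hi.trans l.le_succ), fun hω i hi => ?_⟩
          rcases Nat.le_succ_iff.1 hi with hi | rfl
          · exact hω i hi
          · rw [hzero ω hω, hb]; rfl
        · have hempty : {ω | ∀ i, i ≤ l + 1 → (virtualPath Y hL ω).1 N i = a i} = ∅ := by
            refine eq_empty_of_forall_notMem fun ω hω => hb (Fin.ext ?_)
            rw [← hω (l + 1) le_rfl, hzero ω fun i hi => hω i (hi.trans l.le_succ)]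
            rfl
          rw [hempty, measureReal_empty, mul_zero]

end IsRightProcess

end LabelChain

end VMC

theorem mainTheorem8 {S Ω : Type*} [TopologicalSpace S] [MeasurableSpace S] [BorelSpace S]
    {mΩ : MeasurableSpace Ω} (F : Filtration ℝ≥0 mΩ) (Y : ℝ≥0 → Ω → S) (θ : ℝ≥0 → Ω → Ω)
    (P : S → Measure Ω) (hY : VMC.IsRightProcess F Y θ P)
    (L : ℕ+ → S) (hL : Function.Injective L)
    (hirr : ∀ N, VMC.IsIrregularForItself Y P (L N)) :
    -- the hitting times are stopping times
    (∀ (N : ℕ+) (j : ℕ), IsStoppingTime F (VMC.hitTime Y L N j)) ∧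
    -- almost surely they are non-decreasing, and strictly increasing while finite
    (∀ x, ∀ᵐ ω ∂(P x), ∀ (N : ℕ+) (j : ℕ),
      VMC.hitTime Y L N j ω ≤ VMC.hitTime Y L N (j + 1) ω ∧
      (VMC.hitTime Y L N j ω ≠ ⊤ → VMC.hitTime Y L N j ω < VMC.hitTime Y L N (j + 1) ω)) ∧
    -- almost surely the label of the point hit at a finite hitting time exists and is unique
    (∀ x, ∀ᵐ ω ∂(P x), ∀ (N : ℕ+) (j : ℕ) (t : ℝ≥0), VMC.hitTime Y L N j ω = t →
      ∃! a : ℕ+, a ≤ N ∧ Y t ω = L a) ∧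
    -- the sequence of labels is a virtual Markov chain under every `P x`
    (∃ X : Ω → VMC.VirtualPath,
      (∀ x, ∀ᵐ ω ∂(P x), ∀ (N : ℕ+) (j : ℕ),
        (∀ (t : ℝ≥0) (a : ℕ+), VMC.hitTime Y L N j ω = t → a ≤ N → Y t ω = L a →
          (X ω).1 N j = (a : ℕ)) ∧
        (VMC.hitTime Y L N j ω = ⊤ → (X ω).1 N j = 0)) ∧
      ∀ x, VMC.IsVMC (P x) X) := by 
  have := hY.t2Space
  refine ⟨hY.isStoppingTime_hitTime, fun x => ?_, fun x => ?_, VMC.virtualPath Y hL, fun x => ?_,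
    hY.isVMC_virtualPath hirr hL⟩
  · filter_upwards [hY.ae_mem_goodPaths hirr x] with ω hω N j
    exact ⟨VMC.hitTime_le_succ N j ω, (hω.2 N).1 j⟩
  · filter_upwards [hY.ae_mem_goodPaths hirr x] with ω hω N j t ht
    obtain ⟨a, haN, ha⟩ := VMC.mem_of_hitTime_eq hω.1 ht
    exact ⟨a, ⟨haN, ha.symm⟩, fun b hb => hL (hb.2.symm.trans ha.symm)⟩
  · filter_upwards [hY.ae_mem_goodPaths hirr x] with ω hω N j
    refine ⟨fun t a ht _ ha => VMC.virtualPath_eq_iff hL |>.2 ⟨hω, t, ht, ha⟩, fun ht => ?_⟩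
    rw [VMC.virtualPath_of_mem hL hω, ht, VMC.labelAt_top]
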